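/- Let $n\in\mathbb{N}_0$, $d>0$, $\hbar>0$, let $\mathbb{R}_+^n=[0,\infty)^n$, and let $f:\mathbb{R}_+^n\to[0,\infty)$ be smooth on $\mathbb{R}_+^n\setminus\{0\}$ (up to the boundary) and homogeneous of degree $d$, i.e. $f(tp)=t^df(p)$ for $t>0$. Consider the toric Hamiltonian $H(z)=f(|z_1|^2/2,\dots,|z_n|^2/2)$ on $\mathbb{C}^n$ and the level set $N=f^{-1}(1)\subset\mathbb{R}_+^n$. Assume that $N$ is compact and that the points near which $N$ is a smooth hypersurface of $\mathbb{R}^n$ with nonzero Gauss curvature $K=\det Dn$ are dense in $N$. For a set $S\subset\mathbb{R}^n$ and a point $p\in S$ near which $S$ is a smooth embedded hypersurface with unit normal $n$ and $\langle p,n(p)\rangle\ne0$, put $L(p)=n(p)/\langle p,n(p)\rangle$ (this does not depend on the sign of $n$). Call $p\in S$ a *nice point* of $S$ if $S$ is a smooth hypersurface near $p$, $K(p)\neq0$, $\langle p,n(p)\rangle\neq0$ and $L^{-1}(L(p))=\{p\}$. The *marked action spectrum* of $H^{-1}(1)$ is $$\mathcal{A}=\{(k,\langle p,k\rangle)\mid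 k\in\mathbb{Z}^n,\ p\in N,\ k=c\,\nabla f(p)\text{ for some }c>0\}.$$ The *EBK spectrum* $\sigma_{\mathrm{EBK}}$ of $H$ (without Maslov corrections) is the set of all $E\in\mathbb{R}$ such that $H^{-1}(E)$ contains a torus $L_p=\{z\in\mathbb{C}^n\mid |z_j|^2/2=p_j \text{ for all } j\}$, $p\in\mathbb{R}^n_+$, which is quantized: $\int_\gamma\sum_jx_j\,dy_j\in2\pi\hbar\mathbb{Z}$ for every smooth loop $\gamma$ on $L_p$. Then $N$, and hence the EBK spectrum of $H$, can be reconstructed from the marked action spectrum of $H^{-1}(1)$, as follows. Let $$M=\overline{\{k/a\mid(k,a)\in\mathcal{A},\ a\neq0\}}$$ and let $M'$ be the set of nice points of $M$. Then $$N=\overline{L(M')},$$ the EBK spectrum is $\sigma_{\mathrm{EBK}}=\{f(\hbar m)\mid m\in\mathbb{N}_0^n\}$, and $$\sigma_{\mathrm{EBK}}=\{0\}\cup\Bigl\{E>0\ \Bigm|\ \text{there is } m\in\mathbb{N}_0^n\text{ with }\frac{\hbar m}{E^{1/d}}\in\overline{L(M')}\Bigr\}.$$ -/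

import Mathlib

open scoped ContDiff

noncomputable section

namespace ToricEBK

/-- Euclidean space `ℝⁿ`. -/
abbrev E (n : ℕ) : Type := EuclideanSpace ℝ (Fin n)

/-! ### Hypersurfaces, Gauss curvature and the Legendre transformation -/

/-- `g` is a smooth regular defining function, on the open set `U`, of the part of `S` in `U`;
so `S ∩ U` is a smooth embedded hypersurface (without boundary in `U`). -/
structure IsDefiningFunction {n : ℕ} (S U : Set (E n)) (g : E n → ℝ) : Prop where
  isOpen : IsOpen U
  smooth : ContDiffOn ℝ ∞ g U
  regular : ∀ x ∈ U, gradient g x ≠ 0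
  zeroSet : S ∩ U = {x ∈ U | g x = 0}

/-- The unit normal `∇g / |∇g|` of the level sets of `g`. -/
def unitNormal {n : ℕ} (g : E n → ℝ) (x : E n) : E n :=
  ‖gradient g x‖⁻¹ • gradient g x

/-- The tangent space at `x` of the level set of `g` through `x`. -/
def tangentSpace {n : ℕ} (g : E n → ℝ) (x : E n) : Submodule ℝ (E n) :=
  (Submodule.span ℝ {unitNormal g x})ᗮ

/-- The differential of the Gauss map, as an endomorphism of the tangent space. (The derivative
of a unit normal field is tangent already; the projection only adjusts the codomain.) -/
def gaussMapDeriv {n : ℕ} (g : E n → ℝ) (x : E n) : tangentSpace g x →ₗ[ℝ] tangentSpace g x :=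
  ((tangentSpace g x).orthogonalProjectionOnto.toLinearMap ∘ₗ
    (fderiv ℝ (unitNormal g) x).toLinearMap) ∘ₗ (tangentSpace g x).subtype

/-- The Gauss curvature `K = det Dn` of the level set of `g` through `x`. -/
def gaussCurvature {n : ℕ} (g : E n → ℝ) (x : E n) : ℝ :=
  LinearMap.det (gaussMapDeriv g x)

/-- Near its point `p` the set `S` is a smooth hypersurface, with `K(p) ≠ 0`. (Another defining
function changes `n` at most by a sign, so the choice does not matter.) -/
def HasNonzeroGaussCurvature {n : ℕ} (S : Set (E n)) (p : E n) : Prop :=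
  p ∈ S ∧ ∃ (U : Set (E n)) (g : E n → ℝ),
    IsDefiningFunction S U g ∧ p ∈ U ∧ gaussCurvature g p ≠ 0

/-- `q = L(p)`: near its point `p` the set `S` is a smooth hypersurface, its unit normal satisfies
`⟨p, n(p)⟩ ≠ 0`, and `q = n(p) / ⟨p, n(p)⟩`. -/
def IsLegendreImage {n : ℕ} (S : Set (E n)) (p q : E n) : Prop :=
  p ∈ S ∧ ∃ (U : Set (E n)) (g : E n → ℝ), IsDefiningFunction S U g ∧ p ∈ U ∧
    inner ℝ p (unitNormal g p) ≠ 0 ∧ q = (inner ℝ p (unitNormal g p))⁻¹ • unitNormal g p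

/-- `L(p)` is well defined: it does not depend on the defining function. -/
theorem IsLegendreImage.unique {n : ℕ} {S : Set (E n)} {p q q' : E n}
    (h : IsLegendreImage S p q) (h' : IsLegendreImage S p q') : q = q' := by
  obtain ⟨hp, U, g, hg, hpU, hne, rfl⟩ := h
  obtain ⟨-, V, k, hk, hpV, hne', rfl⟩ := h'
  have hgs : HasStrictFDerivAt g (fderiv ℝ g p) p :=
    (hg.smooth.contDiffAt (hg.isOpen.mem_nhds hpU)).hasStrictFDerivAt (by simp)
  have hks : HasStrictFDerivAt k (fderiv ℝ k p) p :=
    (hk.smooth.contDiffAt (hk.isOpen.mem_nhds hpV)).hasStrictFDerivAt (by simp)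
  have hgp : g p = 0 := ((Set.ext_iff.1 hg.zeroSet p).1 ⟨hp, hpU⟩).2
  have hkp : k p = 0 := ((Set.ext_iff.1 hk.zeroSet p).1 ⟨hp, hpV⟩).2
  have hext : IsLocalExtrOn k {x | g x = g p} p := by
    left
    have : ∀ᶠ x in nhdsWithin p {x | g x = g p}, x ∈ U ∩ V :=
      nhdsWithin_le_nhds ((hg.isOpen.inter hk.isOpen).mem_nhds ⟨hpU, hpV⟩)
    filter_upwards [this, self_mem_nhdsWithin] with x hx hx'
    have h1 : x ∈ S := ((Set.ext_iff.1 hg.zeroSet x).2 ⟨hx.1, by rw [hgp] at hx'; exact hx'⟩).1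
    have h2 := ((Set.ext_iff.1 hk.zeroSet x).1 ⟨h1, hx.2⟩).2
    rw [h2, hkp]
  obtain ⟨a, b, hab, h0⟩ := hext.exists_multipliers_of_hasStrictFDerivAt_1d hgs hks
  have hgrad : a • gradient g p + b • gradient k p = 0 := by
    have := congrArg (InnerProductSpace.toDual ℝ (E n)).symm h0
    simpa [gradient] using this
  have hG := hg.regular p hpU
  have hK := hk.regular p hpV
  have hb : b ≠ 0 := by
    rintro rfl
    simp [hG] at hgrad
    simp [hgrad] at hab
  have ha : a ≠ 0 := by
    rintro rfl
    simp [hK] at hgrad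
    simp [hgrad] at hab
  have hkg : gradient k p = (-(b⁻¹ * a)) • gradient g p := by
    have : b • gradient k p = -(a • gradient g p) := by
      rw [eq_neg_iff_add_eq_zero, add_comm]; exact hgrad
    rw [neg_smul, mul_smul, ← smul_neg, ← this, smul_smul, inv_mul_cancel₀ hb, one_smul]
  have hc : -(b⁻¹ * a) ≠ 0 := neg_ne_zero.2 (mul_ne_zero (inv_ne_zero hb) ha)
  have key : ∀ w : E n, w ≠ 0 → (inner ℝ p (‖w‖⁻¹ • w))⁻¹ • (‖w‖⁻¹ • w) = (inner ℝ p w)⁻¹ • w := by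
    intro w hw
    have : ‖w‖ ≠ 0 := norm_ne_zero_iff.2 hw
    rw [inner_smul_right, smul_smul, mul_inv, inv_inv, mul_right_comm, mul_inv_cancel₀ this,
      one_mul]
  unfold unitNormal
  rw [key _ hG, key _ hK, hkg, inner_smul_right, smul_smul, mul_inv, mul_right_comm,
    inv_mul_cancel₀ hc, one_mul]

/-- The set of nice points of `S`: points `p` near which `S` is a smooth hypersurface such that
`K(p) ≠ 0`, `⟨p, n(p)⟩ ≠ 0` and `L⁻¹(L(p)) = {p}`. -/
def nicePoints {n : ℕ} (S : Set (E n)) : Set (E n) :=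
  {p | HasNonzeroGaussCurvature S p ∧
    ∃ q, IsLegendreImage S p q ∧ ∀ p', IsLegendreImage S p' q → p' = p}

/-- The image `L(T)` of a set `T` of points of `S` under the Legendre transformation `L` of `S`. -/
def legendreImage {n : ℕ} (S T : Set (E n)) : Set (E n) :=
  {q | ∃ p ∈ T, IsLegendreImage S p q}

/-! ### Toric Hamiltonians -/

/-- The closed orthant of `ℝⁿ`. -/
def orthant (n : ℕ) : Set (E n) := {p | ∀ j, 0 ≤ p j}

/-- The point `(|z₁|²/2, …, |zₙ|²/2)`. -/
def momentMap {n : ℕ} (z : EuclideanSpace ℂ (Fin n)) : E n :=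
  WithLp.toLp 2 fun j => ‖z j‖ ^ 2 / 2

/-- The toric Hamiltonian `H(z) = f(|z₁|²/2, …, |zₙ|²/2)`. -/
def toricHamiltonian {n : ℕ} (f : E n → ℝ) (z : EuclideanSpace ℂ (Fin n)) : ℝ :=
  f (momentMap z)

/-- The level set `N = f⁻¹(1)` in the orthant. -/
def levelSet {n : ℕ} (f : E n → ℝ) : Set (E n) := {p ∈ orthant n | f p = 1}

/-- The vector of `ℝⁿ` with the given integer coordinates. -/
def intVec {n : ℕ} (k : Fin n → ℤ) : E n := WithLp.toLp 2 fun j => (k j : ℝ)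

/-- The marked action spectrum of `H⁻¹(1)`: the pairs `(k, ⟨p, k⟩)` with `k ∈ ℤⁿ`, `p ∈ N` and
`k` a positive multiple of `∇f(p)`. At boundary points of the orthant the gradient is the one
formed within the orthant. -/
def markedActionSpectrum {n : ℕ} (f : E n → ℝ) : Set ((Fin n → ℤ) × ℝ) :=
  {x | ∃ p ∈ levelSet f,
    (∃ c : ℝ, 0 < c ∧ intVec x.1 = c • gradientWithin f (orthant n) p) ∧
    x.2 = inner ℝ p (intVec x.1)}

/-- `M`, the closure of the set of all `k / a` with `(k, a) ∈ 𝒜` and `a ≠ 0`. -/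
def actionClosure {n : ℕ} (A : Set ((Fin n → ℤ) × ℝ)) : Set (E n) :=
  closure {q | ∃ x ∈ A, x.2 ≠ 0 ∧ q = x.2⁻¹ • intVec x.1}

/-- The closure of `L(M')`, where `M'` is the set of nice points of `M`. -/
def reconstruction {n : ℕ} (A : Set ((Fin n → ℤ) × ℝ)) : Set (E n) :=
  closure (legendreImage (actionClosure A) (nicePoints (actionClosure A)))

/-! ### The EBK spectrum -/

/-- The invariant torus `L_p = {z | |z_j|²/2 = p_j for all j}`. -/
def invariantTorus {n : ℕ} (p : E n) : Set (EuclideanSpace ℂ (Fin n)) := {z | momentMap z = p}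

/-- The integral of the Liouville form `∑ x_j dy_j` over a `2π`-periodic loop. -/
def liouvilleIntegral {n : ℕ} (γ : ℝ → EuclideanSpace ℂ (Fin n)) : ℝ :=
  ∫ t in (0 : ℝ)..(2 * Real.pi), ∑ j, (γ t j).re * (deriv γ t j).im

/-- A subset of `ℂⁿ` is quantized if the Liouville form integrates to an element of `2πħℤ` over
every smooth loop on it. -/
def IsQuantized {n : ℕ} (ħ : ℝ) (T : Set (EuclideanSpace ℂ (Fin n))) : Prop :=
  ∀ γ : ℝ → EuclideanSpace ℂ (Fin n), ContDiff ℝ ∞ γ → Function.Periodic γ (2 * Real.pi) →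
    (∀ t, γ t ∈ T) → ∃ m : ℤ, liouvilleIntegral γ = 2 * Real.pi * ħ * m

/-- The EBK spectrum (without Maslov corrections) of a Hamiltonian on `ℂⁿ` that is invariant under
the torus action: the energies `e` such that `H⁻¹(e)` contains a quantized invariant torus. -/
def ebkSpectrum {n : ℕ} (ħ : ℝ) (H : EuclideanSpace ℂ (Fin n) → ℝ) : Set ℝ :=
  {e | ∃ p ∈ orthant n, invariantTorus p ⊆ H ⁻¹' {e} ∧ IsQuantized ħ (invariantTorus p)}

/-- The vector `ħ m` for `m ∈ ℕ₀ⁿ`. -/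
def quantumVec {n : ℕ} (ħ : ℝ) (m : Fin n → ℕ) : E n := WithLp.toLp 2 fun j => ħ * (m j : ℝ)

end ToricEBK

end

/-!
The energy `F = f ^ (2 / d) / 2` is homogeneous of degree two, its level set `1 / 2` is `N`, and its
gradient `Φ` (`dualMap`) is homogeneous of degree one. Euler's identity `⟪p, ∇f p⟫ = d f p` gives
`k / a = Φ p` for each `(k, a)` in the marked action spectrum, where `k` is a positive multiple of
`∇f p`. Hence `M ⊆ Φ(N)`, as `Φ(N)` is compact. A point of nonzero Gauss curvature lies in the
interior of the orthant and the derivative of `Φ` is invertible there (`mem_regularPoints`), so near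
it `Φ` takes all rational directions; such points being dense, `M = Φ(N)` (`actionClosure_eq`).

*The Legendre image of `M` lies in `N`* (`eq_of_isLegendreImage`). At a regular point `p` of `N`, a
hypersurface that contains `Φ(N)` near `Φ p` has tangent space `DΦ(p)(Tₚ N)`. Since `DΦ(p)` is
symmetric and invertible with `DΦ(p) p = Φ p`, and `Tₚ N = (Φ p)⊥`, this is `p⊥`, and
`⟪p, Φ p⟫ = 1` then makes `p` the Legendre image of `Φ p`. By density and continuity this holds for
every `p` in `N` such that the Legendre image of `Φ p` is defined. In particular the Legendre
transformation of `M` is injective.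

*The points `p` of `N` with `Φ p` nice are dense* (`exists_injective_point`,
`mem_legendreImage_nicePoints`). If `p` is regular and `Φ⁻¹(Φ p) ∩ N = {p}`, then by compactness `M`
is, near `Φ p`, the level set `1 / 2` of the Legendre dual `F*` of `F`, whose gradient is the local
inverse `Ψ` of `Φ`; so `Φ p` is nice. It remains to see that these `p` are dense. Work in the open
cone and let `Z` be the set of `x` with `F* (Φ x) = F x` but `Ψ (Φ x) ≠ x`. By Sard's lemma in equal
dimensions `Φ(Z)` is a null set: on `Z` the function `u = F* ∘ Φ - F` vanishes, and
`Du = ⟪δ, DΦ ·⟫` for `δ = Ψ (Φ x) - x`, so subtracting `u δ / |δ|²` from `Φ` does not change `Φ` on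
`Z` but makes its derivative singular (`volume_dualMap_image_double`). Faces of the orthant have
null image as well. So arbitrarily close to `Φ p` there are values outside `Φ(Z)`, and rescaling
their preimages to `N` gives the required points.

For the spectrum, a smooth loop on the torus over `p` has Liouville integral `2π ∑ w_j p_j` with
`w_j` its winding numbers, so the torus is quantized exactly when `p = ħ m` with `m ∈ ℕ₀ⁿ`; the last
description follows by homogeneity.
-/

noncomputable section

namespace ToricEBK

open Set Filter Topology MeasureTheory

/-! ### Homogeneous functions on the orthant -/

theorem convex_orthant (n : ℕ) : Convex ℝ (orthant n) := by
  intro x hx y hy a b ha hb _ j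
  have := add_nonneg (mul_nonneg ha (hx j)) (mul_nonneg hb (hy j))
  simpa using this

theorem isOpen_forall_pos (n : ℕ) : IsOpen {x : E n | ∀ j, 0 < x j} := by
  simp only [ofPred_forall]
  exact isOpen_iInter_of_finite fun j => isOpen_lt continuous_const (by fun_prop)

theorem orthant_mem_nhds {n : ℕ} {x : E n} (hx : ∀ j, 0 < x j) : orthant n ∈ 𝓝 x :=
  mem_of_superset ((isOpen_forall_pos n).mem_nhds hx) fun _ hy j => (hy j).le

theorem uniqueDiffOn_orthant (n : ℕ) : UniqueDiffOn ℝ (orthant n) := by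
  refine uniqueDiffOn_convex (convex_orthant n) ⟨WithLp.toLp 2 fun _ => 1, ?_⟩
  exact mem_interior_iff_mem_nhds.2 (orthant_mem_nhds fun j => by simp)

theorem smul_mem_orthant {n : ℕ} {x : E n} (hx : x ∈ orthant n) {t : ℝ} (ht : 0 ≤ t) :
    t • x ∈ orthant n := fun j => by simpa using mul_nonneg ht (hx j)

/-- `f` is a nonnegative function on the orthant, homogeneous of degree `d > 0`, and smooth up to
the boundary away from the origin. -/
structure IsHomogeneousOnOrthant {n : ℕ} (d : ℝ) (f : E n → ℝ) : Prop where
  deg_pos : 0 < d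
  nonneg : ∀ p ∈ orthant n, 0 ≤ f p
  smooth : ContDiffOn ℝ ∞ f (orthant n \ {0})
  hom : ∀ p ∈ orthant n, ∀ t : ℝ, 0 < t → f (t • p) = t ^ d * f p

/-- The points of the orthant at which `f` is positive; a cone, relatively open in the orthant. -/
def positiveCone {n : ℕ} (f : E n → ℝ) : Set (E n) := {x ∈ orthant n | 0 < f x}

/-- The points of the positive cone in the interior of the orthant. -/
def openCone {n : ℕ} (f : E n → ℝ) : Set (E n) := {x | (∀ j, 0 < x j) ∧ 0 < f x}

/-- The function `f ^ (2 / d) / 2`, homogeneous of degree two if `f` is homogeneous of degree `d`.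
Its level set `1 / 2` is the level set `1` of `f`. -/
def energy {n : ℕ} (d : ℝ) (f : E n → ℝ) (x : E n) : ℝ := f x ^ (2 / d) / 2

/-- The gradient of `energy d f` on the positive cone, homogeneous of degree one. It is written in
terms of the gradient within the orthant, so that it makes sense at boundary points. -/
def dualMap {n : ℕ} (d : ℝ) (f : E n → ℝ) (x : E n) : E n :=
  (f x ^ (2 / d - 1) / d) • gradientWithin f (orthant n) x

namespace IsHomogeneousOnOrthant

variable {n : ℕ} {d : ℝ} {f : E n → ℝ}

theorem map_zero (h : IsHomogeneousOnOrthant d f) : f 0 = 0 := by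
  have h0 := h.hom 0 (fun j => by simp) 2 two_pos
  rw [smul_zero] at h0
  have : (1 : ℝ) < 2 ^ d := Real.one_lt_rpow one_lt_two h.deg_pos
  nlinarith

theorem ne_zero (h : IsHomogeneousOnOrthant d f) {x : E n} (hx : x ∈ positiveCone f) : x ≠ 0 := by
  rintro rfl
  exact hx.2.ne' h.map_zero

theorem hasFDerivWithinAt (h : IsHomogeneousOnOrthant d f) {x : E n} (hx : x ∈ orthant n)
    (h0 : x ≠ 0) :
    HasFDerivWithinAt f (InnerProductSpace.toDual ℝ (E n) (gradientWithin f (orthant n) x))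
      (orthant n) x := by
  have h1 : DifferentiableWithinAt ℝ f (orthant n \ {0}) x :=
    (h.smooth.differentiableOn (by simp)) x ⟨hx, h0⟩
  have h2 : DifferentiableWithinAt ℝ f (orthant n) x := by
    rw [sdiff_eq] at h1
    exact (differentiableWithinAt_inter (isOpen_compl_singleton.mem_nhds h0)).1 h1
  exact h2.hasGradientWithinAt

theorem inner_gradientWithin (h : IsHomogeneousOnOrthant d f) {x : E n} (hx : x ∈ orthant n)
    (h0 : x ≠ 0) : inner ℝ x (gradientWithin f (orthant n) x) = d * f x := by
  have h1 : HasDerivAt (fun t : ℝ => t • x) x 1 := by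
    simpa using (hasDerivAt_id (1 : ℝ)).smul_const x
  have hd := h.hasFDerivWithinAt hx h0
  have hpos : ∀ᶠ t : ℝ in 𝓝 1, 0 < t := lt_mem_nhds one_pos
  have h2 := HasFDerivWithinAt.comp_hasDerivAt (t := orthant n) (1 : ℝ)
    (l := f) (f := fun t : ℝ => t • x) (by simpa using hd) h1
    (hpos.mono fun t ht => smul_mem_orthant hx ht.le)
  have h3 : HasDerivAt (fun t : ℝ => t ^ d * f x) (d * f x) 1 := by
    simpa using (Real.hasDerivAt_rpow_const (x := 1) (p := d) (Or.inl one_ne_zero)).mul_const (f x)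
  have h4 := (h3.congr_of_eventuallyEq (hpos.mono fun t ht => h.hom x hx t ht)).unique h2
  rw [real_inner_comm]
  simpa using h4.symm

theorem gradientWithin_smul (h : IsHomogeneousOnOrthant d f) {x : E n} (hx : x ∈ orthant n)
    (h0 : x ≠ 0) {t : ℝ} (ht : 0 < t) :
    gradientWithin f (orthant n) (t • x) = t ^ (d - 1) • gradientWithin f (orthant n) x := by
  have h1 := h.hasFDerivWithinAt (smul_mem_orthant hx ht.le) (smul_ne_zero ht.ne' h0)
  have h2 : HasFDerivWithinAt (fun y : E n => t • y) (t • ContinuousLinearMap.id ℝ (E n))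
      (orthant n) x := ((hasFDerivAt_id x).const_smul t).hasFDerivWithinAt
  have h3 := h1.comp x h2 fun y hy => smul_mem_orthant hy ht.le
  have h4 := ((h.hasFDerivWithinAt hx h0).const_mul (t ^ d)).congr (f₁ := f ∘ fun y => t • y)
    (fun y hy => h.hom y hy t ht) (h.hom x hx t ht)
  have h5 := (uniqueDiffOn_orthant n x hx).eq h3 h4
  have h6 : t • gradientWithin f (orthant n) (t • x) = t ^ d • gradientWithin f (orthant n) x := by
    refine ext_inner_right ℝ fun v => ?_
    have := DFunLike.congr_fun h5 v
    simpa [inner_smul_left] using this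
  rw [Real.rpow_sub_one ht.ne', div_eq_inv_mul, mul_smul, ← h6, smul_smul, inv_mul_cancel₀ ht.ne',
    one_smul]

theorem contDiffOn_gradientWithin (h : IsHomogeneousOnOrthant d f) :
    ContDiffOn ℝ ∞ (gradientWithin f (orthant n)) (orthant n \ {0}) := by
  have hu : UniqueDiffOn ℝ (orthant n \ {0}) := (uniqueDiffOn_orthant n).inter
    isOpen_compl_singleton
  have h1 := h.smooth.fderivWithin (m := ∞) hu (by simp)
  have h2 := (InnerProductSpace.toDual ℝ (E n)).symm.contDiff (n := ∞) |>.comp_contDiffOn h1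
  refine h2.congr fun x hx => ?_
  have := fderivWithin_inter (𝕜 := ℝ) (f := f) (s := orthant n)
    (isOpen_compl_singleton.mem_nhds hx.2)
  simp only [gradientWithin, Function.comp]
  rw [sdiff_eq, this]

theorem positiveCone_subset (h : IsHomogeneousOnOrthant d f) :
    positiveCone f ⊆ orthant n \ {0} := fun _ hx => ⟨hx.1, h.ne_zero hx⟩

theorem contDiffOn_dualMap (h : IsHomogeneousOnOrthant d f) :
    ContDiffOn ℝ ∞ (dualMap d f) (positiveCone f) := by
  have h1 := h.smooth.mono h.positiveCone_subset
  exact ((h1.rpow_const_of_ne fun x hx => hx.2.ne').div_const d).smul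
    (h.contDiffOn_gradientWithin.mono h.positiveCone_subset)

theorem contDiffOn_energy (h : IsHomogeneousOnOrthant d f) :
    ContDiffOn ℝ ∞ (energy d f) (positiveCone f) :=
  ((h.smooth.mono h.positiveCone_subset).rpow_const_of_ne fun _ hx => hx.2.ne').div_const 2

theorem energy_pos {x : E n} (hx : x ∈ positiveCone f) : 0 < energy d f x :=
  half_pos (Real.rpow_pos_of_pos hx.2 _)

theorem inner_dualMap (h : IsHomogeneousOnOrthant d f) {x : E n} (hx : x ∈ positiveCone f) :
    inner ℝ x (dualMap d f x) = 2 * energy d f x := by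
  rw [dualMap, inner_smul_right, h.inner_gradientWithin hx.1 (h.ne_zero hx), energy,
    Real.rpow_sub_one hx.2.ne']
  have := h.deg_pos.ne'
  have := hx.2.ne'
  field_simp

theorem smul_mem_positiveCone (h : IsHomogeneousOnOrthant d f) {x : E n}
    (hx : x ∈ positiveCone f) {t : ℝ} (ht : 0 < t) : t • x ∈ positiveCone f := by
  refine ⟨smul_mem_orthant hx.1 ht.le, ?_⟩
  rw [h.hom x hx.1 t ht]
  exact mul_pos (Real.rpow_pos_of_pos ht _) hx.2

theorem dualMap_smul (h : IsHomogeneousOnOrthant d f) {x : E n} (hx : x ∈ positiveCone f) {t : ℝ}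
    (ht : 0 < t) : dualMap d f (t • x) = t • dualMap d f x := by
  rw [dualMap, dualMap, h.gradientWithin_smul hx.1 (h.ne_zero hx) ht, h.hom x hx.1 t ht, smul_smul,
    smul_smul, Real.mul_rpow (Real.rpow_nonneg ht.le _) hx.2.le, ← Real.rpow_mul ht.le]
  congr 1
  have : t ^ (d * (2 / d - 1)) * t ^ (d - 1) = t := by
    rw [← Real.rpow_add ht]
    have : d * (2 / d - 1) + (d - 1) = 1 := by
      have := h.deg_pos.ne'
      field_simp
      ring
    rw [this, Real.rpow_one]
  calc _ = (t ^ (d * (2 / d - 1)) * t ^ (d - 1)) * (f x ^ (2 / d - 1) / d) := by ring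
    _ = _ := by rw [this]

theorem energy_smul (h : IsHomogeneousOnOrthant d f) {x : E n} (hx : x ∈ positiveCone f) {t : ℝ}
    (ht : 0 < t) : energy d f (t • x) = t ^ 2 * energy d f x := by
  rw [energy, energy, h.hom x hx.1 t ht, Real.mul_rpow (Real.rpow_nonneg ht.le _) hx.2.le,
    ← Real.rpow_mul ht.le]
  have : d * (2 / d) = (2 : ℕ) := by
    have := h.deg_pos.ne'
    field_simp
    norm_num
  rw [this, Real.rpow_natCast]
  ring

theorem mem_levelSet_iff (h : IsHomogeneousOnOrthant d f) {x : E n} :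
    x ∈ levelSet f ↔ x ∈ positiveCone f ∧ energy d f x = 1 / 2 := by
  constructor
  · rintro ⟨hx, h1⟩
    exact ⟨⟨hx, by rw [h1]; exact one_pos⟩, by rw [energy, h1, Real.one_rpow]⟩
  · rintro ⟨hx, h1⟩
    refine ⟨hx.1, ?_⟩
    have h2 : f x ^ (2 / d) = 1 := by
      rw [energy] at h1
      linarith
    exact Real.rpow_left_injOn (div_pos two_pos h.deg_pos).ne' hx.2.le (zero_le_one (α := ℝ))
      (h2.trans (Real.one_rpow _).symm)

theorem dualMap_of_mem_levelSet {x : E n} (hx : x ∈ levelSet f) :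
    dualMap d f x = d⁻¹ • gradientWithin f (orthant n) x := by
  rw [dualMap, hx.2, Real.one_rpow, one_div]

theorem inner_dualMap_of_mem_levelSet (h : IsHomogeneousOnOrthant d f) {x : E n}
    (hx : x ∈ levelSet f) : inner ℝ x (dualMap d f x) = 1 := by
  obtain ⟨h1, h2⟩ := h.mem_levelSet_iff.1 hx
  rw [h.inner_dualMap h1, h2]
  norm_num

/-- The radial projection of the positive cone to the level set. -/
theorem smul_mem_levelSet (h : IsHomogeneousOnOrthant d f) {x : E n} (hx : x ∈ positiveCone f) :
    (√(2 * energy d f x))⁻¹ • x ∈ levelSet f := by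
  have he := energy_pos (d := d) hx
  have hs : 0 < √(2 * energy d f x) := Real.sqrt_pos.2 (by linarith)
  rw [h.mem_levelSet_iff]
  refine ⟨h.smul_mem_positiveCone hx (inv_pos.2 hs), ?_⟩
  rw [h.energy_smul hx (inv_pos.2 hs), inv_pow, Real.sq_sqrt (by linarith)]
  field_simp

/-! ### The dual map at interior points -/

theorem openCone_subset : openCone f ⊆ positiveCone f := fun _ hx => ⟨fun j => (hx.1 j).le, hx.2⟩

theorem isOpen_openCone (h : IsHomogeneousOnOrthant d f) : IsOpen (openCone f) := by
  by_cases hne : (openCone f).Nonempty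
  · rw [isOpen_iff_mem_nhds]
    intro x hx
    have h1 : ContinuousAt f x := by
      refine (h.smooth.continuousOn).continuousAt ?_
      exact inter_mem (orthant_mem_nhds hx.1)
        (isOpen_compl_singleton.mem_nhds (h.ne_zero (openCone_subset hx)))
    exact inter_mem ((isOpen_forall_pos n).mem_nhds hx.1) (h1.eventually (lt_mem_nhds hx.2))
  · rw [not_nonempty_iff_eq_empty.1 hne]
    exact isOpen_empty

theorem positiveCone_mem_nhds (h : IsHomogeneousOnOrthant d f) {x : E n} (hx : x ∈ openCone f) :
    positiveCone f ∈ 𝓝 x := mem_of_superset (h.isOpen_openCone.mem_nhds hx) openCone_subset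

theorem contDiffAt_dualMap (h : IsHomogeneousOnOrthant d f) {x : E n} (hx : x ∈ openCone f) :
    ContDiffAt ℝ ∞ (dualMap d f) x := h.contDiffOn_dualMap.contDiffAt (h.positiveCone_mem_nhds hx)

theorem contDiffAt_energy (h : IsHomogeneousOnOrthant d f) {x : E n} (hx : x ∈ openCone f) :
    ContDiffAt ℝ ∞ (energy d f) x := h.contDiffOn_energy.contDiffAt (h.positiveCone_mem_nhds hx)

theorem hasFDerivAt_dualMap (h : IsHomogeneousOnOrthant d f) {x : E n} (hx : x ∈ openCone f) :
    HasFDerivAt (dualMap d f) (fderiv ℝ (dualMap d f) x) x :=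
  ((h.contDiffAt_dualMap hx).differentiableAt (by simp)).hasFDerivAt

theorem hasFDerivAt_energy (h : IsHomogeneousOnOrthant d f) {x : E n} (hx : x ∈ openCone f) :
    HasFDerivAt (energy d f) (InnerProductSpace.toDual ℝ (E n) (dualMap d f x)) x := by
  have hx' := openCone_subset hx
  have h1 := (h.hasFDerivWithinAt hx'.1 (h.ne_zero hx')).hasFDerivAt (orthant_mem_nhds hx.1)
  have h2 := (h1.rpow_const (p := 2 / d) (Or.inl hx.2.ne')).mul_const (2⁻¹ : ℝ)
  refine (h2.congr_fderiv ?_).congr_of_eventuallyEq (Eventually.of_forall fun y => rfl)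
  rw [dualMap, map_smul, smul_smul]
  congr 1
  have := h.deg_pos.ne'
  field_simp

theorem fderiv_dualMap_symm (h : IsHomogeneousOnOrthant d f) {x : E n} (hx : x ∈ openCone f)
    (v w : E n) :
    inner ℝ (fderiv ℝ (dualMap d f) x v) w = inner ℝ v (fderiv ℝ (dualMap d f) x w) := by
  have h1 : ∀ᶠ y in 𝓝 x, HasFDerivAt (energy d f)
      (InnerProductSpace.toDual ℝ (E n) (dualMap d f y)) y :=
    mem_of_superset (h.isOpen_openCone.mem_nhds hx) fun y hy => h.hasFDerivAt_energy hy
  have h2 := (innerSL ℝ : E n →L[ℝ] _).hasFDerivAt.comp x (h.hasFDerivAt_dualMap hx)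
  have h3 := second_derivative_symmetric_of_eventually h1 h2 v w
  have h4 : inner ℝ (fderiv ℝ (dualMap d f) x v) w = inner ℝ (fderiv ℝ (dualMap d f) x w) v := h3
  rw [h4, real_inner_comm]

/-- Euler's identity for the dual map, which is homogeneous of degree one. -/
theorem fderiv_dualMap_self (h : IsHomogeneousOnOrthant d f) {x : E n} (hx : x ∈ openCone f) :
    fderiv ℝ (dualMap d f) x x = dualMap d f x := by
  have h1 : HasDerivAt (fun t : ℝ => t • x) x 1 := by
    simpa using (hasDerivAt_id (1 : ℝ)).smul_const x
  have h2 := HasFDerivAt.comp_hasDerivAt (1 : ℝ) (l := dualMap d f) (f := fun t : ℝ => t • x)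
    (by simpa using h.hasFDerivAt_dualMap hx) h1
  have h3 : HasDerivAt (fun t : ℝ => t • dualMap d f x) (dualMap d f x) 1 := by
    simpa using (hasDerivAt_id (1 : ℝ)).smul_const (dualMap d f x)
  have hpos : ∀ᶠ t : ℝ in 𝓝 1, 0 < t := lt_mem_nhds one_pos
  exact h2.unique (h3.congr_of_eventuallyEq
    (hpos.mono fun t ht => h.dualMap_smul (openCone_subset hx) ht))

end IsHomogeneousOnOrthant

/-! ### Lagrange multipliers and Gauss curvature -/

/-- If `h` is constant along the level set of `g` through `p`, then its derivative vanishes on the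
tangent space of that level set. -/
theorem fderiv_apply_eq_zero_of_eventually {n : ℕ} {g h : E n → ℝ} {g' h' : E n →L[ℝ] ℝ} {p : E n}
    (hg : HasStrictFDerivAt g g' p) (hh : HasStrictFDerivAt h h' p) (hg' : g' ≠ 0)
    (hgh : ∀ᶠ x in 𝓝 p, g x = g p → h x = h p) {v : E n} (hv : g' v = 0) : h' v = 0 := by
  have hext : IsLocalExtrOn h {x | g x = g p} p := by
    left
    filter_upwards [nhdsWithin_le_nhds hgh, self_mem_nhdsWithin] with x hx hx'
    exact (hx hx').ge
  obtain ⟨a, b, hab, h0⟩ := hext.exists_multipliers_of_hasStrictFDerivAt_1d hg hh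
  have hb : b ≠ 0 := by
    rintro rfl
    simp [hg'] at h0
    simp [h0] at hab
  have := DFunLike.congr_fun h0 v
  simpa [hv, hb] using this

theorem IsDefiningFunction.contDiffAt {n : ℕ} {S U : Set (E n)} {g : E n → ℝ}
    (h : IsDefiningFunction S U g) {x : E n} (hx : x ∈ U) : ContDiffAt ℝ ∞ g x :=
  h.smooth.contDiffAt (h.isOpen.mem_nhds hx)

theorem IsDefiningFunction.hasStrictFDerivAt {n : ℕ} {S U : Set (E n)} {g : E n → ℝ}
    (h : IsDefiningFunction S U g) {x : E n} (hx : x ∈ U) :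
    HasStrictFDerivAt g (InnerProductSpace.toDual ℝ (E n) (gradient g x)) x := by
  simpa [gradient] using (h.contDiffAt hx).hasStrictFDerivAt (by simp)

theorem IsDefiningFunction.mem_iff {n : ℕ} {S U : Set (E n)} {g : E n → ℝ}
    (h : IsDefiningFunction S U g) {x : E n} (hx : x ∈ U) : x ∈ S ↔ g x = 0 := by
  have := Set.ext_iff.1 h.zeroSet x
  simpa [hx] using this

theorem IsDefiningFunction.contDiffAt_gradient {n : ℕ} {S U : Set (E n)} {g : E n → ℝ}
    (h : IsDefiningFunction S U g) {x : E n} (hx : x ∈ U) : ContDiffAt ℝ ∞ (gradient g) x :=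
  (InnerProductSpace.toDual ℝ (E n)).symm.contDiff.contDiffAt.comp x
    ((h.contDiffAt hx).fderiv_right (m := ∞) (by simp))

theorem toDual_ne_zero {n : ℕ} {w : E n} (hw : w ≠ 0) : InnerProductSpace.toDual ℝ (E n) w ≠ 0 :=
  (map_ne_zero_iff _ (InnerProductSpace.toDual ℝ (E n)).injective).2 hw

/-- If a vector is orthogonal to the tangent space `w⊥`, then it is a multiple of `w`. -/
theorem eq_smul_of_forall_inner {n : ℕ} {u w : E n}
    (h : ∀ v, inner ℝ w v = 0 → inner ℝ u v = 0) : ∃ c : ℝ, u = c • w := by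
  have h1 : u ∈ (Submodule.span ℝ {w})ᗮᗮ := by
    rw [Submodule.mem_orthogonal']
    intro v hv
    exact h v (Submodule.mem_orthogonal_singleton_iff_inner_right.1 hv)
  rw [Submodule.orthogonal_orthogonal] at h1
  obtain ⟨c, hc⟩ := Submodule.mem_span_singleton.1 h1
  exact ⟨c, hc.symm⟩

/-- Nonvanishing of the Gauss curvature in terms of the derivative of the gradient: normalizing a
normal field changes its derivative along tangent vectors only by a factor and by normal vectors. -/
theorem gaussCurvature_ne_zero_iff {n : ℕ} {g : E n → ℝ} {p : E n}
    (hg : DifferentiableAt ℝ (gradient g) p) (h0 : gradient g p ≠ 0) :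
    gaussCurvature g p ≠ 0 ↔ ∀ v : E n, inner ℝ (gradient g p) v = 0 →
      (∃ c : ℝ, fderiv ℝ (gradient g) p v = c • gradient g p) → v = 0 := by
  have hn : ‖gradient g p‖ ≠ 0 := norm_ne_zero_iff.2 h0
  have hT : ∀ v : E n, v ∈ tangentSpace g p ↔ inner ℝ (gradient g p) v = 0 := by
    intro v
    rw [tangentSpace, Submodule.mem_orthogonal_singleton_iff_inner_right, unitNormal,
      inner_smul_left]
    simp [h0]
  have hspan : Submodule.span ℝ {unitNormal g p} = Submodule.span ℝ {gradient g p} :=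
    Submodule.span_singleton_smul_eq (IsUnit.mk0 _ (inv_ne_zero hn)) _
  obtain ⟨a, ha⟩ : ∃ a : E n →L[ℝ] ℝ, HasFDerivAt (fun x => ‖gradient g x‖⁻¹) a p := by
    have := ((hg.norm ℝ h0).inv hn).hasFDerivAt
    exact ⟨_, this⟩
  have hD : ∀ v, fderiv ℝ (unitNormal g) p v =
      ‖gradient g p‖⁻¹ • fderiv ℝ (gradient g) p v + a v • gradient g p := by
    intro v
    have := (ha.smul hg.hasFDerivAt).fderiv
    change fderiv ℝ (unitNormal g) p = _ at this
    rw [this]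
    simp
  have hker : ∀ v : tangentSpace g p, gaussMapDeriv g p v = 0 ↔
      ∃ c : ℝ, fderiv ℝ (gradient g) p v = c • gradient g p := by
    intro v
    have h1 : gaussMapDeriv g p v =
      (tangentSpace g p).orthogonalProjectionOnto (fderiv ℝ (unitNormal g) p v) := rfl
    rw [h1, Submodule.orthogonalProjectionOnto_eq_zero_iff]
    change _ ∈ (Submodule.span ℝ {unitNormal g p})ᗮᗮ ↔ _
    rw [Submodule.orthogonal_orthogonal, hspan, Submodule.mem_span_singleton, hD]
    constructor
    · rintro ⟨c, hc⟩
      refine ⟨‖gradient g p‖ * (c - a v), ?_⟩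
      rw [mul_smul, sub_smul, hc, add_sub_cancel_right, smul_smul, mul_inv_cancel₀ hn, one_smul]
    · rintro ⟨c, hc⟩
      exact ⟨‖gradient g p‖⁻¹ * c + a v, by rw [hc, add_smul, mul_smul]⟩
  have hdet : gaussCurvature g p ≠ 0 ↔ LinearMap.ker (gaussMapDeriv g p) = ⊥ := by
    rw [gaussCurvature, ← isUnit_iff_ne_zero, ← LinearMap.isUnit_iff_isUnit_det,
      LinearMap.isUnit_iff_ker_eq_bot]
  rw [hdet, LinearMap.ker_eq_bot']
  constructor
  · intro H v hv hc
    exact congrArg Subtype.val (H ⟨v, (hT v).2 hv⟩ ((hker _).2 hc))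
  · intro H v hv
    exact Subtype.ext (H v ((hT v).1 v.2) ((hker v).1 hv))

theorem legendre_eq {n : ℕ} (p : E n) {w : E n} (hw : w ≠ 0) :
    (inner ℝ p (‖w‖⁻¹ • w))⁻¹ • (‖w‖⁻¹ • w) = (inner ℝ p w)⁻¹ • w := by
  have : ‖w‖ ≠ 0 := norm_ne_zero_iff.2 hw
  rw [inner_smul_right, smul_smul, mul_inv, inv_inv, mul_right_comm, mul_inv_cancel₀ this, one_mul]

/-- Through each tangent vector of a regular level set there is a curve in the level set. -/
theorem exists_curve_of_tangent {n : ℕ} {g : E n → ℝ} {g' : E n →L[ℝ] ℝ} {p v : E n}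
    (hg : HasStrictFDerivAt g g' p) (hg' : g' ≠ 0) (hv : g' v = 0) :
    ∃ γ : ℝ → E n, γ 0 = p ∧ HasDerivAt γ v 0 ∧ ∀ᶠ t in 𝓝 0, g (γ t) = g p := by
  have hr : (g' : E n →ₗ[ℝ] ℝ).range = ⊤ := by
    rw [LinearMap.range_eq_top]
    exact LinearMap.surjective (fun h => hg' (by ext x; exact DFunLike.congr_fun h x))
  let w : (g' : E n →ₗ[ℝ] ℝ).ker := ⟨v, hv⟩
  have hc : HasDerivAt (fun t : ℝ => t • w) w 0 := by
    simpa using (hasDerivAt_id (0 : ℝ)).smul_const w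
  refine ⟨fun t => hg.implicitFunction g g' hr (g p) (t • w), ?_, ?_, ?_⟩
  · simp
  · have h1 := (hg.to_implicitFunction hr).hasFDerivAt
    exact HasFDerivAt.comp_hasDerivAt (0 : ℝ) (l := hg.implicitFunction g g' hr (g p))
      (f := fun t : ℝ => t • w) (by simpa using h1) hc
  · have h2 : Tendsto (fun t : ℝ => (g p, t • w)) (𝓝 0) (𝓝 (g p, 0)) := by
      have : Continuous (fun t : ℝ => (g p, t • w)) := by fun_prop
      simpa using this.tendsto 0
    exact h2.eventually (hg.map_implicitFunction_eq hr)

/-! ### Curved points of the level set -/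

/-- The points of the open cone at which the dual map is a local diffeomorphism. -/
def regularPoints {n : ℕ} (d : ℝ) (f : E n → ℝ) : Set (E n) :=
  {x ∈ openCone f | (fderiv ℝ (dualMap d f) x).det ≠ 0}

theorem det_ne_zero_iff {n : ℕ} (A : E n →L[ℝ] E n) : A.det ≠ 0 ↔ ∀ v, A v = 0 → v = 0 := by
  rw [ContinuousLinearMap.det, ← isUnit_iff_ne_zero, ← LinearMap.isUnit_iff_isUnit_det,
    LinearMap.isUnit_iff_ker_eq_bot, LinearMap.ker_eq_bot']
  rfl

namespace IsHomogeneousOnOrthant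

variable {n : ℕ} {d : ℝ} {f : E n → ℝ}

theorem isOpen_regularPoints (h : IsHomogeneousOnOrthant d f) : IsOpen (regularPoints d f) := by
  have h1 : ContinuousOn (fderiv ℝ (dualMap d f)) (openCone f) := fun x hx =>
    ((h.contDiffAt_dualMap hx).fderiv_right (m := ∞) (by simp)).continuousAt.continuousWithinAt
  have h2 : ContinuousOn (fun x => (fderiv ℝ (dualMap d f) x).det) (openCone f) :=
    ContinuousLinearMap.continuous_det.comp_continuousOn h1
  exact h2.isOpen_inter_preimage h.isOpen_openCone isOpen_compl_singleton

theorem exists_equiv_fderiv (h : IsHomogeneousOnOrthant d f) {x : E n}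
    (hx : x ∈ regularPoints d f) :
    ∃ e : E n ≃L[ℝ] E n, HasFDerivAt (dualMap d f) (e : E n →L[ℝ] E n) x :=
  ⟨(fderiv ℝ (dualMap d f) x).toContinuousLinearEquivOfDetNeZero hx.2,
    h.hasFDerivAt_dualMap hx.1⟩

theorem exists_local_inverse (h : IsHomogeneousOnOrthant d f) {x : E n}
    (hx : x ∈ regularPoints d f) :
    ∃ e : OpenPartialHomeomorph (E n) (E n), ⇑e = dualMap d f ∧ x ∈ e.source ∧
      e.source ⊆ regularPoints d f := by
  obtain ⟨A, hA⟩ := h.exists_equiv_fderiv hx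
  have hc := h.contDiffAt_dualMap hx.1
  refine ⟨(hc.toOpenPartialHomeomorph (dualMap d f) hA (by simp)).restrOpen _
    h.isOpen_regularPoints, rfl, ?_, ?_⟩
  · exact ⟨hc.mem_toOpenPartialHomeomorph_source hA (by simp), hx⟩
  · exact inter_subset_right

theorem contDiffAt_local_inverse (h : IsHomogeneousOnOrthant d f)
    {e : OpenPartialHomeomorph (E n) (E n)} (he : ⇑e = dualMap d f)
    (hs : e.source ⊆ regularPoints d f) {y : E n} (hy : y ∈ e.target) :
    ContDiffAt ℝ ∞ e.symm y := by
  have hx := hs (e.map_target hy)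
  obtain ⟨A, hA⟩ := h.exists_equiv_fderiv hx
  exact e.contDiffAt_symm hy (he ▸ hA) (he ▸ h.contDiffAt_dualMap hx.1)

/-- At a boundary point of the orthant the level set is not a hypersurface: the tangent space would
be a coordinate hyperplane containing `p`, but `f` has positive derivative in the direction `p`. -/
theorem pos_of_isDefiningFunction (h : IsHomogeneousOnOrthant d f) {U : Set (E n)} {g : E n → ℝ}
    (hg : IsDefiningFunction (levelSet f) U g) {p : E n} (hp : p ∈ levelSet f) (hpU : p ∈ U)
    (j : Fin n) : 0 < p j := by
  refine (hp.1 j).lt_of_ne fun hj => ?_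
  have hpc := (h.mem_levelSet_iff.1 hp).1
  have hgp : g p = 0 := (hg.mem_iff hpU).1 hp
  have hgs := hg.hasStrictFDerivAt hpU
  have hG := hg.regular p hpU
  have hg' : InnerProductSpace.toDual ℝ (E n) (gradient g p) ≠ 0 := toDual_ne_zero hG
  have hmem : ∀ᶠ x in 𝓝 p, g x = g p → x ∈ levelSet f := by
    filter_upwards [hg.isOpen.mem_nhds hpU] with x hx hgx
    exact (hg.mem_iff hx).2 (hgx.trans hgp)
  -- the coordinate `x j` has a minimum at `p` on the level set
  have hext : IsLocalExtrOn (fun x : E n => x j) {x | g x = g p} p := by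
    left
    filter_upwards [nhdsWithin_le_nhds hmem, self_mem_nhdsWithin] with x hx hx'
    rw [← hj]
    exact (hx hx').1 j
  have hcoord : HasStrictFDerivAt (fun x : E n => x j)
      (EuclideanSpace.proj j : E n →L[ℝ] ℝ) p :=
    (EuclideanSpace.proj j : E n →L[ℝ] ℝ).hasStrictFDerivAt
  obtain ⟨a, b, hab, h0⟩ := hext.exists_multipliers_of_hasStrictFDerivAt_1d hgs hcoord
  have ha : a ≠ 0 := by
    rintro rfl
    have h1 := DFunLike.congr_fun h0 (EuclideanSpace.single j 1)
    have : b = 0 := by simpa using h1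
    simp [this] at hab
  have htan : InnerProductSpace.toDual ℝ (E n) (gradient g p) p = 0 := by
    have h1 := DFunLike.congr_fun h0 p
    simpa [← hj, ha] using h1
  obtain ⟨γ, hγ0, hγ, hγg⟩ := exists_curve_of_tangent hgs hg' htan
  have hγN : ∀ᶠ t in 𝓝 (0 : ℝ), γ t ∈ levelSet f := by
    have := hγ.continuousAt.tendsto
    rw [hγ0] at this
    filter_upwards [this.eventually hmem, hγg] with t h1 h2 using h1 h2
  have h1 := HasFDerivWithinAt.comp_hasDerivAt (t := orthant n) (0 : ℝ) (l := f) (f := γ)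
    (by rw [hγ0]; exact h.hasFDerivWithinAt hp.1 (h.ne_zero hpc)) hγ (hγN.mono fun t ht => ht.1)
  have h2 := (hasDerivAt_const (0 : ℝ) (1 : ℝ)).congr_of_eventuallyEq
    (hγN.mono fun t ht => ht.2 : f ∘ γ =ᶠ[𝓝 0] fun _ => 1)
  have h3 := h1.unique h2
  have h4 := h.inner_gradientWithin hp.1 (h.ne_zero hpc)
  rw [hp.2, mul_one, real_inner_comm] at h4
  exact h.deg_pos.ne' (h4.symm.trans h3)

theorem hasStrictFDerivAt_energy (h : IsHomogeneousOnOrthant d f) {x : E n} (hx : x ∈ openCone f) :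
    HasStrictFDerivAt (energy d f) (InnerProductSpace.toDual ℝ (E n) (dualMap d f x)) x :=
  (h.contDiffAt_energy hx).hasStrictFDerivAt' (h.hasFDerivAt_energy hx) (by simp)

theorem mem_levelSet_iff_of_mem_openCone (h : IsHomogeneousOnOrthant d f) {x : E n}
    (hx : x ∈ openCone f) : x ∈ levelSet f ↔ energy d f x = 1 / 2 := by
  rw [h.mem_levelSet_iff, and_iff_right (openCone_subset hx)]

theorem dualMap_ne_zero (h : IsHomogeneousOnOrthant d f) {x : E n} (hx : x ∈ positiveCone f) :
    dualMap d f x ≠ 0 := fun h0 => by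
  have := h.inner_dualMap hx
  rw [h0, inner_zero_right] at this
  linarith [energy_pos (d := d) hx]

/-- A point of the level set with nonzero Gauss curvature is a regular point of the dual map. -/
theorem mem_regularPoints (h : IsHomogeneousOnOrthant d f) {p : E n}
    (hp : HasNonzeroGaussCurvature (levelSet f) p) : p ∈ regularPoints d f := by
  obtain ⟨hpN, U, g, hg, hpU, hK⟩ := hp
  have hpos : ∀ x ∈ levelSet f, x ∈ U → x ∈ openCone f := fun x hx hxU =>
    ⟨fun j => h.pos_of_isDefiningFunction hg hx hxU j, (h.mem_levelSet_iff.1 hx).1.2⟩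
  have hpc := hpos p hpN hpU
  refine ⟨hpc, (det_ne_zero_iff _).2 fun v hv => ?_⟩
  have hgrad : DifferentiableAt ℝ (gradient g) p := (hg.contDiffAt_gradient hpU).differentiableAt
    (by simp)
  -- on the level set the two normal fields are parallel
  have hpar : ∀ x ∈ levelSet f, x ∈ U →
      (inner ℝ x (gradient g x) : ℝ) • dualMap d f x = gradient g x := by
    intro x hx hxU
    obtain ⟨c, hc⟩ : ∃ c : ℝ, gradient g x = c • dualMap d f x := by
      refine eq_smul_of_forall_inner fun w hw => ?_
      have hxc := hpos x hx hxU
      refine fderiv_apply_eq_zero_of_eventually (h.hasStrictFDerivAt_energy hxc)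
        (hg.hasStrictFDerivAt hxU) ?_ ?_ hw
      · exact toDual_ne_zero (h.dualMap_ne_zero (openCone_subset hxc))
      · filter_upwards [h.isOpen_openCone.mem_nhds hxc, hg.isOpen.mem_nhds hxU] with y hy hyU hyx
        rw [(hg.mem_iff hxU).1 hx, (hg.mem_iff hyU).1]
        rw [h.mem_levelSet_iff_of_mem_openCone hy, hyx]
        exact (h.mem_levelSet_iff.1 hx).2
    rw [hc, inner_smul_right, h.inner_dualMap_of_mem_levelSet hx, mul_one]
  have hvT : inner ℝ (gradient g p) v = 0 := by
    have h1 : inner ℝ (dualMap d f p) v = 0 := by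
      rw [← h.fderiv_dualMap_self hpc, h.fderiv_dualMap_symm hpc, hv, inner_zero_right]
    rw [← hpar p hpN hpU, inner_smul_left, h1, mul_zero]
  refine (gaussCurvature_ne_zero_iff hgrad (hg.regular p hpU)).1 hK v hvT ?_
  have hu : ContDiffAt ℝ ∞
      (fun x => (inner ℝ x (gradient g x) : ℝ) • dualMap d f x - gradient g x) p :=
    ((contDiffAt_id.inner ℝ (hg.contDiffAt_gradient hpU)).smul (h.contDiffAt_dualMap hpc)).sub
      (hg.contDiffAt_gradient hpU)
  have hu0 := hu.hasStrictFDerivAt (by simp)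
  have hDu : fderiv ℝ (fun x => (inner ℝ x (gradient g x) : ℝ) • dualMap d f x - gradient g x) p v
      = 0 := by
    refine ext_inner_left ℝ fun w => ?_
    rw [inner_zero_right]
    have h1 := (innerSL ℝ w).hasStrictFDerivAt.comp p hu0
    refine fderiv_apply_eq_zero_of_eventually (hg.hasStrictFDerivAt hpU) h1
      (toDual_ne_zero (hg.regular p hpU)) ?_ hvT
    filter_upwards [hg.isOpen.mem_nhds hpU] with y hyU hy
    rw [(hg.mem_iff hpU).1 hpN] at hy
    rw [hpar p hpN hpU, hpar y ((hg.mem_iff hyU).2 hy) hyU, sub_self, sub_self]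
  obtain ⟨a, ha⟩ : ∃ a : E n →L[ℝ] ℝ, HasFDerivAt (fun x => (inner ℝ x (gradient g x) : ℝ)) a p :=
    ⟨_, ((contDiffAt_id.inner ℝ (hg.contDiffAt_gradient hpU)).differentiableAt
      (n := ∞) (by simp)).hasFDerivAt⟩
  have h2 := (ha.smul (h.hasFDerivAt_dualMap hpc)).sub hgrad.hasFDerivAt
  have h3 : HasFDerivAt (fun x => (inner ℝ x (gradient g x) : ℝ) • dualMap d f x - gradient g x)
    _ p := h2
  rw [h3.fderiv] at hDu
  have h4 : a v • dualMap d f p = fderiv ℝ (gradient g) p v := by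
    simpa [hv, sub_eq_zero] using hDu
  have hne : (inner ℝ p (gradient g p) : ℝ) ≠ 0 := fun h0 => by
    have := hpar p hpN hpU
    rw [h0, zero_smul] at this
    exact hg.regular p hpU this.symm
  refine ⟨a v * (inner ℝ p (gradient g p))⁻¹, ?_⟩
  nth_rw 2 [← hpar p hpN hpU]
  rw [smul_smul, mul_assoc, inv_mul_cancel₀ hne, mul_one, h4]

/-- The factor that rescales `e.symm y` to the level set, for a local inverse `e.symm` of the dual
map, tends to one as `y` approaches the image of a point of the level set. -/
theorem tendsto_normalization (h : IsHomogeneousOnOrthant d f) {p : E n} (hp : p ∈ levelSet f)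
    {e : OpenPartialHomeomorph (E n) (E n)} (he : ⇑e = dualMap d f)
    (hs : e.source ⊆ regularPoints d f) (hpe : p ∈ e.source) :
    Tendsto (fun y => (√(2 * energy d f (e.symm y)))⁻¹) (𝓝 (dualMap d f p)) (𝓝 1) := by
  have hyt : dualMap d f p ∈ e.target := he ▸ e.map_source hpe
  have hinv : e.symm (dualMap d f p) = p := he ▸ e.left_inv hpe
  have h1 := (h.contDiffAt_energy (hs hpe).1).continuousAt.tendsto
  rw [(h.mem_levelSet_iff.1 hp).2] at h1
  have h2 := (e.continuousAt_symm hyt).tendsto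
  rw [hinv] at h2
  simpa using (((h1.comp h2).const_mul 2).sqrt).inv₀ (by simp)

end IsHomogeneousOnOrthant

/-! ### The closure of the normalized action spectrum -/

/-- The positive real multiples of integer vectors. -/
def integralRays (n : ℕ) : Set (E n) :=
  {y | ∃ (m : ℝ) (k : Fin n → ℤ), 0 < m ∧ y = m⁻¹ • intVec k}

theorem dense_integralRays (n : ℕ) : Dense (integralRays n) := by
  intro y
  refine mem_closure_of_tendsto (b := atTop) (f := fun N : ℕ => ((N : ℝ) + 1)⁻¹ •
    intVec fun j => ⌊((N : ℝ) + 1) * y j⌋) ?_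
    (Eventually.of_forall fun N => ⟨N + 1, _, by positivity, rfl⟩)
  rw [(PiLp.homeomorph 2 fun _ : Fin n => ℝ).isInducing.tendsto_nhds_iff, tendsto_pi_nhds]
  intro j
  have h1 : Tendsto (fun N : ℕ => y j - 1 / ((N : ℝ) + 1)) atTop (𝓝 (y j)) := by
    simpa using (tendsto_const_nhds (x := y j)).sub
      (tendsto_one_div_add_atTop_nhds_zero_nat (𝕜 := ℝ))
  refine tendsto_of_tendsto_of_tendsto_of_le_of_le h1 tendsto_const_nhds (fun N => ?_) fun N => ?_
  · have hN : (0 : ℝ) < N + 1 := by positivity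
    have := Int.sub_one_lt_floor (((N : ℝ) + 1) * y j)
    change _ ≤ ((N : ℝ) + 1)⁻¹ * (⌊((N : ℝ) + 1) * y j⌋ : ℝ)
    rw [inv_mul_eq_div, le_div_iff₀ hN, sub_mul, one_div, inv_mul_cancel₀ hN.ne']
    linarith
  · have hN : (0 : ℝ) < N + 1 := by positivity
    have := Int.floor_le (((N : ℝ) + 1) * y j)
    change ((N : ℝ) + 1)⁻¹ * (⌊((N : ℝ) + 1) * y j⌋ : ℝ) ≤ y j
    rw [inv_mul_eq_div, div_le_iff₀ hN]
    linarith

namespace IsHomogeneousOnOrthant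

variable {n : ℕ} {d : ℝ} {f : E n → ℝ}

theorem inner_smul_gradientWithin (h : IsHomogeneousOnOrthant d f) {p w : E n}
    (hp : p ∈ levelSet f) {c : ℝ} (hc : 0 < c) (hw : w = c • gradientWithin f (orthant n) p) :
    inner ℝ p w ≠ 0 ∧ (inner ℝ p w)⁻¹ • w = dualMap d f p := by
  have h1 : inner ℝ p w = c * d := by
    rw [hw, inner_smul_right, h.inner_gradientWithin hp.1 (h.ne_zero (h.mem_levelSet_iff.1 hp).1),
      hp.2, mul_one]
  have h2 : c * d ≠ 0 := (mul_pos hc h.deg_pos).ne'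
  rw [h1]
  refine ⟨h2, ?_⟩
  rw [hw, dualMap_of_mem_levelSet hp, smul_smul, mul_inv, mul_right_comm, inv_mul_cancel₀ hc.ne',
    one_mul]

theorem continuousOn_dualMap (h : IsHomogeneousOnOrthant d f) :
    ContinuousOn (dualMap d f) (levelSet f) :=
  h.contDiffOn_dualMap.continuousOn.mono fun _ hx => (h.mem_levelSet_iff.1 hx).1

/-- Near a regular point of the level set the dual map takes all nearby rational directions. -/
theorem dualMap_mem_actionClosure (h : IsHomogeneousOnOrthant d f) {p : E n}
    (hp : p ∈ levelSet f) (hpr : p ∈ regularPoints d f) :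
    dualMap d f p ∈ actionClosure (markedActionSpectrum f) := by
  obtain ⟨e, he, hpe, hes⟩ := h.exists_local_inverse hpr
  have hyt : dualMap d f p ∈ e.target := he ▸ e.map_source hpe
  have hmem : dualMap d f p ∈ closure (integralRays n) := dense_integralRays n _
  have := mem_closure_iff_nhdsWithin_neBot.1 hmem
  have htend := (h.tendsto_normalization hp he hes hpe).smul
    (tendsto_id (x := 𝓝 (dualMap d f p)))
  rw [one_smul] at htend
  refine mem_closure_of_tendsto (b := 𝓝[integralRays n] (dualMap d f p))
    (htend.mono_left nhdsWithin_le_nhds) ?_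
  filter_upwards [self_mem_nhdsWithin, nhdsWithin_le_nhds (e.open_target.mem_nhds hyt)]
    with y ⟨m, k, hm, hy⟩ hye
  have hx := openCone_subset (hes (e.map_target hye)).1
  have hΦ : dualMap d f (e.symm y) = y := he ▸ e.right_inv hye
  have hr : 0 < (√(2 * energy d f (e.symm y)))⁻¹ :=
    inv_pos.2 (Real.sqrt_pos.2 (mul_pos two_pos (energy_pos hx)))
  have hN := h.smul_mem_levelSet hx
  have hΦ' := h.dualMap_smul hx hr
  rw [hΦ] at hΦ'
  set r := (√(2 * energy d f (e.symm y)))⁻¹ with hrdef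
  have hk : intVec k = (m * r⁻¹ * d⁻¹) • gradientWithin f (orthant n) (r • e.symm y) := by
    rw [mul_smul, ← dualMap_of_mem_levelSet hN, hΦ', smul_smul, inv_mul_cancel_right₀ hr.ne', hy,
      smul_smul, mul_inv_cancel₀ hm.ne', one_smul]
  have hc : 0 < m * r⁻¹ * d⁻¹ := mul_pos (mul_pos hm (inv_pos.2 hr)) (inv_pos.2 h.deg_pos)
  obtain ⟨h1, h2⟩ := h.inner_smul_gradientWithin hN hc hk
  exact ⟨(k, inner ℝ (r • e.symm y) (intVec k)), ⟨_, hN, ⟨_, hc, hk⟩, rfl⟩, h1, by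
    rw [h2, hΦ', id]⟩

theorem actionClosure_eq (h : IsHomogeneousOnOrthant d f) (hcomp : IsCompact (levelSet f))
    (hdense : levelSet f ⊆ closure (levelSet f ∩ regularPoints d f)) :
    actionClosure (markedActionSpectrum f) = dualMap d f '' levelSet f := by
  apply Subset.antisymm
  · refine closure_minimal ?_ (hcomp.image_of_continuousOn h.continuousOn_dualMap).isClosed
    rintro q ⟨⟨k, a⟩, ⟨p, hp, ⟨c, hc, hk⟩, ha⟩, -, rfl⟩
    refine ⟨p, hp, ?_⟩
    change a = _ at ha
    rw [ha]
    exact (h.inner_smul_gradientWithin hp hc hk).2.symm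
  · rintro _ ⟨p, hp, rfl⟩
    have : (𝓝[levelSet f ∩ regularPoints d f] p).NeBot :=
      mem_closure_iff_nhdsWithin_neBot.1 (hdense hp)
    have hcont := (h.continuousOn_dualMap p hp).mono_left
      (nhdsWithin_mono p (inter_subset_left (t := regularPoints d f)))
    refine isClosed_closure.mem_of_tendsto hcont ?_
    filter_upwards [self_mem_nhdsWithin] with x hx
    exact h.dualMap_mem_actionClosure hx.1 hx.2

/-- At a regular point `p` of the level set, every smooth hypersurface containing the image of the
level set near `dualMap d f p` has normal direction `p` there. -/
theorem gradient_eq_smul (h : IsHomogeneousOnOrthant d f) {U : Set (E n)} {g : E n → ℝ}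
    (hg : IsDefiningFunction (dualMap d f '' levelSet f) U g) {p : E n} (hp : p ∈ levelSet f)
    (hpr : p ∈ regularPoints d f) (hpU : dualMap d f p ∈ U) :
    ∃ c : ℝ, gradient g (dualMap d f p) = c • p := by
  have hpc := hpr.1
  have hΦ : HasStrictFDerivAt (dualMap d f) (fderiv ℝ (dualMap d f) p) p :=
    (h.contDiffAt_dualMap hpc).hasStrictFDerivAt (by simp)
  have hev : ∀ᶠ x in 𝓝 p, energy d f x = energy d f p →
      g (dualMap d f x) = g (dualMap d f p) := by
    filter_upwards [h.isOpen_openCone.mem_nhds hpc,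
      hΦ.continuousAt.preimage_mem_nhds (hg.isOpen.mem_nhds hpU)] with x hx hxU hxe
    rw [(hg.mem_iff hpU).1 ⟨p, hp, rfl⟩, (hg.mem_iff hxU).1]
    refine ⟨x, (h.mem_levelSet_iff_of_mem_openCone hx).2 ?_, rfl⟩
    rw [hxe, (h.mem_levelSet_iff.1 hp).2]
  obtain ⟨c, hc⟩ : ∃ c : ℝ, fderiv ℝ (dualMap d f) p (gradient g (dualMap d f p)) =
      c • dualMap d f p := by
    refine eq_smul_of_forall_inner fun v hv => ?_
    have h1 := fderiv_apply_eq_zero_of_eventually (h.hasStrictFDerivAt_energy hpc)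
      ((hg.hasStrictFDerivAt hpU).comp p hΦ)
      (toDual_ne_zero (h.dualMap_ne_zero (openCone_subset hpc))) hev hv
    rw [h.fderiv_dualMap_symm hpc]
    exact h1
  refine ⟨c, sub_eq_zero.1 ((det_ne_zero_iff _).1 hpr.2 _ ?_)⟩
  rw [map_sub, map_smul, hc, h.fderiv_dualMap_self hpc, sub_self]

/-- Legendre duality: the Legendre transformation of the image of the level set under the dual map
inverts the dual map. No curvature assumption at the point is needed, by density of the regular
points and continuity. -/
theorem eq_of_isLegendreImage (h : IsHomogeneousOnOrthant d f)
    (hdense : levelSet f ⊆ closure (levelSet f ∩ regularPoints d f)) {p q : E n}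
    (hp : p ∈ levelSet f)
    (hq : IsLegendreImage (dualMap d f '' levelSet f) (dualMap d f p) q) : q = p := by
  obtain ⟨-, U, g, hg, hpU, hne, rfl⟩ := hq
  have hG := hg.regular _ hpU
  rw [unitNormal, legendre_eq _ hG]
  have hne' : (inner ℝ (dualMap d f p) (gradient g (dualMap d f p)) : ℝ) ≠ 0 := by
    intro h0
    rw [unitNormal, inner_smul_right, h0, mul_zero] at hne
    exact hne rfl
  have : (𝓝[levelSet f ∩ regularPoints d f] p).NeBot :=
    mem_closure_iff_nhdsWithin_neBot.1 (hdense hp)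
  have h1 : Tendsto (dualMap d f) (𝓝[levelSet f ∩ regularPoints d f] p) (𝓝 (dualMap d f p)) :=
    (h.continuousOn_dualMap p hp).mono_left (nhdsWithin_mono p inter_subset_left)
  have h2 := (hg.contDiffAt_gradient hpU).continuousAt.tendsto.comp h1
  have h3 : Tendsto (fun x : E n => x) (𝓝[levelSet f ∩ regularPoints d f] p) (𝓝 p) :=
    nhdsWithin_le_nhds
  have h4 := (h1.inner (𝕜 := ℝ) h2).smul h3
  have h5 : (inner ℝ (dualMap d f p) (gradient g (dualMap d f p)) : ℝ) • p =
      gradient g (dualMap d f p) := by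
    refine tendsto_nhds_unique (h4.congr' ?_) h2
    filter_upwards [self_mem_nhdsWithin, h1.eventually (hg.isOpen.mem_nhds hpU)] with x hx hxU
    obtain ⟨c, hc⟩ := h.gradient_eq_smul hg hx.1 hx.2 hxU
    simp only [Function.comp]
    rw [hc, inner_smul_right, real_inner_comm, h.inner_dualMap_of_mem_levelSet hx.1, mul_one]
  nth_rw 2 [← h5]
  rw [smul_smul, inv_mul_cancel₀ hne', one_smul]

end IsHomogeneousOnOrthant

/-! ### The dual energy and points with coinciding tangent hyperplane -/

/-- The Legendre dual of the energy, for a local inverse `e.symm` of the dual map: it equals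
`energy d f ∘ e.symm`, written here as half a pairing by Euler's identity. -/
def dualEnergy {n : ℕ} (e : OpenPartialHomeomorph (E n) (E n)) (y : E n) : ℝ :=
  inner ℝ (e.symm y) y / 2

namespace IsHomogeneousOnOrthant

variable {n : ℕ} {d : ℝ} {f : E n → ℝ} {e : OpenPartialHomeomorph (E n) (E n)}

theorem dualMap_symm (he : ⇑e = dualMap d f) {y : E n} (hy : y ∈ e.target) :
    dualMap d f (e.symm y) = y := he ▸ e.right_inv hy

theorem dualEnergy_eq (h : IsHomogeneousOnOrthant d f) (he : ⇑e = dualMap d f)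
    (hs : e.source ⊆ regularPoints d f) {y : E n} (hy : y ∈ e.target) :
    dualEnergy e y = energy d f (e.symm y) := by
  have h1 := h.inner_dualMap (openCone_subset (hs (e.map_target hy)).1)
  rw [dualMap_symm he hy] at h1
  rw [dualEnergy, h1]
  ring

theorem hasFDerivAt_dualEnergy (h : IsHomogeneousOnOrthant d f) (he : ⇑e = dualMap d f)
    (hs : e.source ⊆ regularPoints d f) {y : E n} (hy : y ∈ e.target) :
    HasFDerivAt (dualEnergy e) (InnerProductSpace.toDual ℝ (E n) (e.symm y)) y := by
  have hx := (hs (e.map_target hy)).1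
  have hB := ((h.contDiffAt_local_inverse he hs hy).differentiableAt (by simp)).hasFDerivAt
  have h1 : HasFDerivAt (dualEnergy e) _ y := ((hB.inner ℝ (hasFDerivAt_id y)).mul_const (2⁻¹ : ℝ))
  have h2 := (h.hasFDerivAt_energy hx).comp y hB
  have h3 := h2.congr_of_eventuallyEq (f₁ := dualEnergy e)
    (mem_of_superset (e.open_target.mem_nhds hy) fun z hz => h.dualEnergy_eq he hs hz)
  refine h1.congr_fderiv ?_
  have h4 := h1.unique h3
  ext v
  have h5 := DFunLike.congr_fun h4 v
  simp [dualMap_symm he hy, real_inner_comm] at h5 ⊢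
  linarith

theorem gradient_dualEnergy (h : IsHomogeneousOnOrthant d f) (he : ⇑e = dualMap d f)
    (hs : e.source ⊆ regularPoints d f) {y : E n} (hy : y ∈ e.target) (c : ℝ) :
    gradient (fun z => dualEnergy e z - c) y = e.symm y := by
  have := ((h.hasFDerivAt_dualEnergy he hs hy).sub_const c).hasGradientAt.gradient
  simpa using this

theorem volume_dualMap_image_boundary (h : IsHomogeneousOnOrthant d f) (j : Fin n) :
    volume (dualMap d f '' {x ∈ positiveCone f | x j = 0}) = 0 := by
  let P : E n →L[ℝ] E n := ContinuousLinearMap.id ℝ (E n) -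
    (EuclideanSpace.proj j : E n →L[ℝ] ℝ).smulRight (EuclideanSpace.single j (1 : ℝ))
  have hP : ∀ y : E n, y j = 0 → P y = y := fun y hy => by simp [P, hy]
  refine addHaar_image_eq_zero_of_det_fderivWithin_eq_zero volume
    (f' := fun x => (fderivWithin ℝ (dualMap d f) (positiveCone f) x) ∘L P) ?_ ?_
  · intro x hx
    have h1 : HasFDerivWithinAt (dualMap d f) (fderivWithin ℝ (dualMap d f) (positiveCone f) x)
        (positiveCone f) x :=
      ((h.contDiffOn_dualMap x hx.1).differentiableWithinAt (by simp)).hasFDerivWithinAt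
    have h2 := HasFDerivWithinAt.comp x (g := dualMap d f) (f := P) (by rw [hP x hx.2]; exact h1)
      (P.hasFDerivWithinAt (s := {x ∈ positiveCone f | x j = 0}))
      (fun y hy => by rw [hP y hy.2]; exact hy.1)
    exact h2.congr (fun y hy => by rw [Function.comp, hP y hy.2]) (by rw [Function.comp, hP x hx.2])
  · intro x _
    by_contra hdet
    have h1 := (det_ne_zero_iff _).1 hdet (EuclideanSpace.single j (1 : ℝ)) (by simp [P])
    simp at h1

/-- Almost no point of the target of `e.symm` is the image, under the dual map, of a second point of
the same energy. At such a second point `x`, with `δ = e.symm (dualMap d f x) - x`, the function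
`dualEnergy e ∘ dualMap d f - energy d f` vanishes and has the derivative `⟪δ, D(dualMap d f) ·⟫`,
so that within the set of these points the dual map has a derivative with image in `δ⊥`. -/
theorem volume_dualMap_image_double (h : IsHomogeneousOnOrthant d f) (he : ⇑e = dualMap d f)
    (hs : e.source ⊆ regularPoints d f) :
    volume (dualMap d f '' {x ∈ positiveCone f | dualMap d f x ∈ e.target ∧
      dualEnergy e (dualMap d f x) = energy d f x ∧ e.symm (dualMap d f x) ≠ x}) = 0 := by
  let Z := {x ∈ positiveCone f | dualMap d f x ∈ e.target ∧
      dualEnergy e (dualMap d f x) = energy d f x ∧ e.symm (dualMap d f x) ≠ x}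
  have hcover : Z ⊆ (Z ∩ openCone f) ∪ ⋃ j, {x ∈ positiveCone f | x j = 0} := by
    intro x hx
    by_cases hpos : ∀ j, 0 < x j
    · exact Or.inl ⟨hx, hpos, hx.1.2⟩
    · push Not at hpos
      obtain ⟨j, hj⟩ := hpos
      exact Or.inr (mem_iUnion.2 ⟨j, hx.1, le_antisymm hj (hx.1.1 j)⟩)
  refine measure_mono_null (image_mono hcover) ?_
  rw [image_union, image_iUnion]
  refine measure_union_null ?_ (measure_iUnion_null fun j => h.volume_dualMap_image_boundary j)
  let δ : E n → E n := fun x => e.symm (dualMap d f x) - x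
  let Q : E n → E n →L[ℝ] E n := fun x => ContinuousLinearMap.id ℝ (E n) -
    (innerSL ℝ (δ x)).smulRight ((‖δ x‖ ^ 2)⁻¹ • δ x)
  refine addHaar_image_eq_zero_of_det_fderivWithin_eq_zero volume
    (f' := fun x => Q x ∘L fderiv ℝ (dualMap d f) x) ?_ ?_
  · rintro x ⟨hx, hxo⟩
    have hA := h.hasFDerivAt_dualMap hxo
    have hu := ((h.hasFDerivAt_dualEnergy he hs hx.2.1).comp x hA).sub (h.hasFDerivAt_energy hxo)
    have h1 := (hA.sub (hu.smul_const ((‖δ x‖ ^ 2)⁻¹ • δ x))).hasFDerivWithinAt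
      (s := Z ∩ openCone f)
    refine (h1.congr_fderiv ?_).congr ?_ ?_
    · ext1 v
      have h2 : inner ℝ (dualMap d f x) v = inner ℝ x (fderiv ℝ (dualMap d f) x v) := by
        rw [← h.fderiv_dualMap_symm hxo, h.fderiv_dualMap_self hxo]
      simp [Q, δ, h2]
    · intro y hy
      simp [hy.1.2.2.1]
    · simp [hx.2.2.1]
  · rintro x ⟨hx, -⟩
    have hδ : δ x ≠ 0 := sub_ne_zero.2 hx.2.2.2
    have hQ : (Q x).det = 0 := by
      by_contra hdet
      refine hδ ((det_ne_zero_iff _).1 hdet (δ x) ?_)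
      have : ‖δ x‖ ^ 2 ≠ 0 := pow_ne_zero _ (norm_ne_zero_iff.2 hδ)
      simp [Q, smul_smul, this]
    rw [ContinuousLinearMap.det] at hQ ⊢
    rw [ContinuousLinearMap.toLinearMap_comp, LinearMap.det_comp, hQ, zero_mul]

/-- Near a regular point of the level set there are regular points of it at which the dual map takes
a value that it takes nowhere else on the level set: otherwise the images of double points would
cover an open set. -/
theorem exists_injective_point (h : IsHomogeneousOnOrthant d f) {p : E n} (hp : p ∈ levelSet f)
    (hpr : p ∈ regularPoints d f) {O : Set (E n)} (hO : O ∈ 𝓝 p) :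
    ∃ x ∈ O, x ∈ levelSet f ∧ x ∈ regularPoints d f ∧
      ∀ z ∈ levelSet f, dualMap d f z = dualMap d f x → z = x := by
  obtain ⟨e, he, hpe, hs⟩ := h.exists_local_inverse hpr
  have hyt : dualMap d f p ∈ e.target := he ▸ e.map_source hpe
  have htend := (h.tendsto_normalization hp he hs hpe).smul (e.continuousAt_symm hyt).tendsto
  rw [one_smul, show e.symm (dualMap d f p) = p from he ▸ e.left_inv hpe] at htend
  have hV := inter_mem (e.open_target.mem_nhds hyt)
    (htend (inter_mem hO (h.isOpen_regularPoints.mem_nhds hpr)))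
  have hZ := h.volume_dualMap_image_double he hs
  obtain ⟨y, ⟨hye, hyO⟩, hyZ⟩ := not_subset.1 fun hsub =>
    (Measure.measure_pos_of_mem_nhds volume hV).ne' (measure_mono_null hsub hZ)
  have hxe := hs (e.map_target hye)
  have hxc := openCone_subset hxe.1
  have hE := mul_pos two_pos (energy_pos (d := d) hxc)
  have hr : 0 < √(2 * energy d f (e.symm y)) := Real.sqrt_pos.2 hE
  refine ⟨_, hyO.1, h.smul_mem_levelSet hxc, hyO.2, fun z hz hzx => ?_⟩
  set r := √(2 * energy d f (e.symm y)) with hrdef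
  rw [h.dualMap_smul hxc (inv_pos.2 hr), dualMap_symm he hye] at hzx
  obtain ⟨hzc, hze⟩ := h.mem_levelSet_iff.1 hz
  -- rescale `z` to the energy of `e.symm y`
  have h1 : dualMap d f (r • z) = y := by
    rw [h.dualMap_smul hzc hr, hzx, smul_smul, mul_inv_cancel₀ hr.ne', one_smul]
  have h2 : energy d f (r • z) = energy d f (e.symm y) := by
    rw [h.energy_smul hzc hr, hze, hrdef, Real.sq_sqrt hE.le]
    ring
  have h3 : e.symm y = r • z := by
    by_contra hne
    refine hyZ ⟨r • z, ⟨h.smul_mem_positiveCone hzc hr, ?_, ?_, ?_⟩, h1⟩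
    · rwa [h1]
    · rw [h1, h.dualEnergy_eq he hs hye, h2]
    · rwa [h1]
  change z = r⁻¹ • e.symm y
  rw [h3, smul_smul, inv_mul_cancel₀ hr.ne', one_smul]

/-! ### Nice points -/

/-- Near the image of a regular point `p` with no other point in its fibre, the image of the level
set is the level set `1 / 2` of the dual energy. -/
theorem exists_isDefiningFunction (h : IsHomogeneousOnOrthant d f)
    (hcomp : IsCompact (levelSet f)) {p : E n} (hpr : p ∈ regularPoints d f)
    (hinj : ∀ z ∈ levelSet f, dualMap d f z = dualMap d f p → z = p) :
    ∃ (e : OpenPartialHomeomorph (E n) (E n)) (U : Set (E n)), ⇑e = dualMap d f ∧ p ∈ e.source ∧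
      e.source ⊆ regularPoints d f ∧ U ⊆ e.target ∧ dualMap d f p ∈ U ∧
      IsDefiningFunction (dualMap d f '' levelSet f) U fun y => dualEnergy e y - 1 / 2 := by
  obtain ⟨e, he, hpe, hs⟩ := h.exists_local_inverse hpr
  have hK : IsClosed (dualMap d f '' (levelSet f \ e.source)) :=
    ((hcomp.diff e.open_source).image_of_continuousOn
      (h.continuousOn_dualMap.mono sdiff_subset)).isClosed
  refine ⟨e, e.target \ dualMap d f '' (levelSet f \ e.source), he, hpe, hs, sdiff_subset,
    ⟨he ▸ e.map_source hpe, ?_⟩, e.open_target.sdiff hK, ?_, ?_, ?_⟩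
  · rintro ⟨z, hz, hzp⟩
    rw [hinj z hz.1 hzp] at hz
    exact hz.2 hpe
  · intro y hy
    exact ((((h.contDiffAt_local_inverse he hs hy.1).inner ℝ contDiffAt_id).div_const 2).sub
      contDiffAt_const).contDiffWithinAt
  · intro y hy
    rw [h.gradient_dualEnergy he hs hy.1]
    exact h.ne_zero (openCone_subset (hs (e.map_target hy.1)).1)
  · ext y
    constructor
    · rintro ⟨⟨z, hz, rfl⟩, hy⟩
      refine ⟨hy, ?_⟩
      have hze : z ∈ e.source := by
        by_contra hze
        exact hy.2 ⟨z, ⟨hz, hze⟩, rfl⟩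
      have : e.symm (dualMap d f z) = z := he ▸ e.left_inv hze
      rw [h.dualEnergy_eq he hs hy.1, this, (h.mem_levelSet_iff.1 hz).2, sub_self]
    · rintro ⟨hy, hy0⟩
      refine ⟨⟨e.symm y, ?_, dualMap_symm he hy.1⟩, hy⟩
      rw [h.mem_levelSet_iff_of_mem_openCone (hs (e.map_target hy.1)).1,
        ← h.dualEnergy_eq he hs hy.1]
      exact sub_eq_zero.1 hy0

theorem mem_legendreImage_nicePoints (h : IsHomogeneousOnOrthant d f)
    (hcomp : IsCompact (levelSet f))
    (hdense : levelSet f ⊆ closure (levelSet f ∩ regularPoints d f)) {p : E n}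
    (hp : p ∈ levelSet f) (hpr : p ∈ regularPoints d f)
    (hinj : ∀ z ∈ levelSet f, dualMap d f z = dualMap d f p → z = p) :
    p ∈ legendreImage (dualMap d f '' levelSet f) (nicePoints (dualMap d f '' levelSet f)) := by
  obtain ⟨e, U, he, hpe, hs, hUt, hpU, hg⟩ := h.exists_isDefiningFunction hcomp hpr hinj
  have hyt := hUt hpU
  have hgrad : gradient (fun y => dualEnergy e y - 1 / 2) (dualMap d f p) = p := by
    rw [h.gradient_dualEnergy he hs hyt]
    exact he ▸ e.left_inv hpe
  have hp0 : p ≠ 0 := h.ne_zero (openCone_subset hpr.1)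
  have hinner : inner ℝ (dualMap d f p) p = 1 := by
    rw [real_inner_comm]
    exact h.inner_dualMap_of_mem_levelSet hp
  have hL : IsLegendreImage (dualMap d f '' levelSet f) (dualMap d f p) p := by
    refine ⟨⟨p, hp, rfl⟩, U, _, hg, hpU, ?_, ?_⟩
    · rw [unitNormal, hgrad, inner_smul_right, hinner, mul_one]
      exact inv_ne_zero (norm_ne_zero_iff.2 hp0)
    · rw [unitNormal, hgrad, legendre_eq _ hp0, hinner, inv_one, one_smul]
  refine ⟨dualMap d f p, ⟨⟨⟨p, hp, rfl⟩, U, _, hg, hpU, ?_⟩, p, hL, ?_⟩, hL⟩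
  · refine (gaussCurvature_ne_zero_iff
      ((hg.contDiffAt_gradient hpU).differentiableAt (by simp)) (hg.regular _ hpU)).2 ?_
    rw [hgrad]
    rintro v hv ⟨c, hc⟩
    -- the derivative of the gradient is inverse to the derivative of the dual map
    have hev : gradient (fun y => dualEnergy e y - 1 / 2) =ᶠ[𝓝 (dualMap d f p)] e.symm :=
      mem_of_superset (e.open_target.mem_nhds hyt) fun z hz => h.gradient_dualEnergy he hs hz _
    have hB := (((h.contDiffAt_local_inverse he hs hyt).differentiableAt (by simp)).hasFDerivAt)
    rw [hev.fderiv_eq] at hc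
    have hinv : e.symm (dualMap d f p) = p := he ▸ e.left_inv hpe
    have h1 := HasFDerivAt.comp (dualMap d f p) (g := dualMap d f) (f := e.symm)
      (by rw [hinv]; exact h.hasFDerivAt_dualMap hpr.1) hB
    have h2 : HasFDerivAt (dualMap d f ∘ e.symm) (ContinuousLinearMap.id ℝ (E n))
        (dualMap d f p) := (hasFDerivAt_id _).congr_of_eventuallyEq
      (mem_of_superset (e.open_target.mem_nhds hyt) fun z hz => dualMap_symm he hz)
    have h3 := DFunLike.congr_fun (h1.unique h2) v
    have h4 : c • dualMap d f p = v := by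
      rwa [ContinuousLinearMap.comp_apply, hc, map_smul, h.fderiv_dualMap_self hpr.1] at h3
    have h5 : c = 0 := by
      rwa [← h4, inner_smul_right, h.inner_dualMap_of_mem_levelSet hp, mul_one] at hv
    rw [← h4, h5, zero_smul]
  · rintro _ hy'
    obtain ⟨p', hp', rfl⟩ := hy'.1
    rw [h.eq_of_isLegendreImage hdense hp' hy']

theorem reconstruction_eq (h : IsHomogeneousOnOrthant d f) (hcomp : IsCompact (levelSet f))
    (hcurv : levelSet f ⊆ closure {p | HasNonzeroGaussCurvature (levelSet f) p}) :
    reconstruction (markedActionSpectrum f) = levelSet f := by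
  have hdense : levelSet f ⊆ closure (levelSet f ∩ regularPoints d f) :=
    hcurv.trans (closure_mono fun p hp => ⟨hp.1, h.mem_regularPoints hp⟩)
  rw [reconstruction, h.actionClosure_eq hcomp hdense]
  apply Subset.antisymm
  · refine closure_minimal ?_ hcomp.isClosed
    rintro q ⟨_, -, hq⟩
    obtain ⟨p, hp, rfl⟩ := hq.1
    rwa [h.eq_of_isLegendreImage hdense hp hq]
  · refine fun p hp => closure_minimal ?_ isClosed_closure (hdense hp)
    rintro p ⟨hp, hpr⟩
    refine mem_closure_iff_nhds.2 fun O hO => ?_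
    obtain ⟨x, hxO, hx, hxr, hinj⟩ := h.exists_injective_point hp hpr hO
    exact ⟨x, hxO, h.mem_legendreImage_nicePoints hcomp hdense hx hxr hinj⟩

end IsHomogeneousOnOrthant

/-! ### Quantized tori -/

/-- A smooth loop on a circle of radius `√(2r)` bounds the signed area `2πr w`, for an integer `w`,
its winding number. -/
theorem exists_int_integral_circle {c : ℝ → ℂ} (hc : ContDiff ℝ 1 c)
    (hper : c (2 * Real.pi) = c 0) {r : ℝ} (hr : ∀ t, ‖c t‖ ^ 2 / 2 = r) :
    ∃ w : ℤ, ∫ t in (0 : ℝ)..(2 * Real.pi), (c t).re * (deriv c t).im = 2 * Real.pi * r * w := by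
  have hsq : ∀ t, (c t).re ^ 2 + (c t).im ^ 2 = 2 * r := by
    intro t
    have := hr t
    rw [← Complex.normSq_eq_norm_sq, Complex.normSq_apply] at this
    linarith
  have hD : ∀ t, HasDerivAt c (deriv c t) t := fun t =>
    (hc.differentiable (by simp) t).hasDerivAt
  have hre : ∀ t, HasDerivAt (fun s => (c s).re) (deriv c t).re t := fun t =>
    Complex.reCLM.hasFDerivAt.comp_hasDerivAt t (hD t)
  have him : ∀ t, HasDerivAt (fun s => (c s).im) (deriv c t).im t := fun t =>
    Complex.imCLM.hasFDerivAt.comp_hasDerivAt t (hD t)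
  have hcd : Continuous (deriv c) := hc.continuous_deriv (by simp)
  have hcc : Continuous c := hc.continuous
  have hcre := Complex.continuous_re.comp hcc
  have hcim := Complex.continuous_im.comp hcc
  have hdre := Complex.continuous_re.comp hcd
  have hdim := Complex.continuous_im.comp hcd
  simp only [Function.comp_def] at hcre hcim hdre hdim
  by_cases hr0 : r = 0
  · refine ⟨0, ?_⟩
    have h0 : ∀ t, (c t).re = 0 := fun t => by
      have := hsq t
      nlinarith [sq_nonneg (c t).re, sq_nonneg (c t).im]
    simp [h0]
  -- the angular velocity
  set α : ℝ → ℝ := fun t => ((c t).re * (deriv c t).im - (c t).im * (deriv c t).re) / (2 * r)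
    with hα
  have hαc : Continuous α := ((hcre.mul hdim).sub (hcim.mul hdre)).div_const _
  have hrad : ∀ t, (c t).re * (deriv c t).re + (c t).im * (deriv c t).im = 0 := by
    intro t
    have h1 := ((hre t).pow 2).add ((him t).pow 2)
    have h2 := (hasDerivAt_const t (2 * r)).congr_of_eventuallyEq
      (Eventually.of_forall fun s => hsq s)
    have h3 := h1.unique h2
    simp at h3
    linarith
  have hode : ∀ t, deriv c t = (α t * Complex.I) * c t := by
    intro t
    have h1 := hsq t
    have h2 := hrad t
    have h3 : (2 * r) * α t = (c t).re * (deriv c t).im - (c t).im * (deriv c t).re := by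
      simp only [hα]
      field_simp
    have h2r : 2 * r ≠ 0 := mul_ne_zero two_ne_zero hr0
    apply Complex.ext
    · apply mul_left_cancel₀ h2r
      have : ((α t * Complex.I) * c t).re = -(α t * (c t).im) := by simp
      rw [this]
      linear_combination (-(deriv c t).re) * h1 + (c t).re * h2 + (c t).im * h3
    · apply mul_left_cancel₀ h2r
      have : ((α t * Complex.I) * c t).im = α t * (c t).re := by simp
      rw [this]
      linear_combination (-(deriv c t).im) * h1 + (c t).im * h2 - (c t).re * h3
  set θ : ℝ → ℝ := fun t => ∫ s in (0 : ℝ)..t, α s with hθ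
  have hθD : ∀ t, HasDerivAt θ (α t) t := fun t => hαc.integral_hasStrictDerivAt 0 t |>.hasDerivAt
  have hconst : ∀ t, HasDerivAt (fun s => Complex.exp (-(θ s * Complex.I)) * c s) 0 t := by
    intro t
    have h1 := ((((hθD t).ofReal_comp).mul_const Complex.I).neg.cexp).mul (hD t)
    refine h1.congr_deriv ?_
    rw [hode t]
    ring
  have heq := is_const_of_deriv_eq_zero (fun t => (hconst t).differentiableAt)
    (fun t => (hconst t).deriv) (2 * Real.pi) 0
  have hc0 : c 0 ≠ 0 := by
    intro h0
    have := hr 0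
    rw [h0] at this
    simp at this
    exact hr0 this.symm
  have hθ0 : θ 0 = 0 := by simp [hθ]
  rw [hper, hθ0] at heq
  have hexp : Complex.exp (-(θ (2 * Real.pi) * Complex.I)) = 1 :=
    mul_right_cancel₀ hc0 (by simpa using heq)
  obtain ⟨w, hw⟩ := Complex.exp_eq_one_iff.1 hexp
  have hθw : θ (2 * Real.pi) = 2 * Real.pi * (-w : ℤ) := by
    have := congrArg Complex.im hw
    simp at this
    push_cast
    linarith
  refine ⟨-w, ?_⟩
  have hcont : Continuous fun t => (deriv c t).re * (c t).im + (c t).re * (deriv c t).im :=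
    (hdre.mul hcim).add (hcre.mul hdim)
  -- `x dy` differs from half of `x dy - y dx` by half of the exact form `d(xy)`
  have hexact : ∫ t in (0 : ℝ)..(2 * Real.pi),
      ((deriv c t).re * (c t).im + (c t).re * (deriv c t).im) = 0 := by
    rw [intervalIntegral.integral_eq_sub_of_hasDerivAt (f := fun t => (c t).re * (c t).im)
      (fun t _ => (hre t).mul (him t))
      (hcont.intervalIntegrable _ _), hper, sub_self]
  have hsplit : ∀ t, (c t).re * (deriv c t).im =
      r * α t + (1 / 2) * ((deriv c t).re * (c t).im + (c t).re * (deriv c t).im) := by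
    intro t
    simp only [hα]
    field_simp
    ring
  rw [intervalIntegral.integral_congr fun t _ => hsplit t,
    intervalIntegral.integral_add ((hαc.const_mul r).intervalIntegrable _ _)
    ((hcont.const_mul _).intervalIntegrable _ _),
    intervalIntegral.integral_const_mul, intervalIntegral.integral_const_mul, hexact]
  change r * θ (2 * Real.pi) + _ = _
  rw [hθw]
  ring

theorem mem_invariantTorus_iff {n : ℕ} {p : E n} {z : EuclideanSpace ℂ (Fin n)} :
    z ∈ invariantTorus p ↔ ∀ j, ‖z j‖ ^ 2 / 2 = p j := by
  constructor
  · rintro rfl j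
    rfl
  · intro h
    ext j
    exact h j

/-- The point with real coordinates `√(2 p j)` lies on the torus over `p`. -/
theorem toLp_sqrt_mem_invariantTorus {n : ℕ} {p : E n} (hp : p ∈ orthant n) :
    WithLp.toLp 2 (fun j => ((√(2 * p j) : ℝ) : ℂ)) ∈ invariantTorus p := by
  rw [mem_invariantTorus_iff]
  intro j
  have : 0 ≤ 2 * p j := mul_nonneg zero_le_two (hp j)
  change ‖((√(2 * p j) : ℝ) : ℂ)‖ ^ 2 / 2 = p j
  rw [Complex.norm_real, Real.norm_eq_abs, sq_abs, Real.sq_sqrt this]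
  ring

theorem hasDerivAt_coord {n : ℕ} {γ : ℝ → EuclideanSpace ℂ (Fin n)} (hγ : Differentiable ℝ γ)
    (t : ℝ) (j : Fin n) : HasDerivAt (fun s => γ s j) (deriv γ t j) t :=
  ((EuclideanSpace.proj j : EuclideanSpace ℂ (Fin n) →L[ℂ] ℂ).restrictScalars
    ℝ).hasFDerivAt.comp_hasDerivAt t (hγ t).hasDerivAt

theorem isQuantized_invariantTorus_quantumVec {n : ℕ} (ħ : ℝ) (m : Fin n → ℕ) :
    IsQuantized ħ (invariantTorus (quantumVec ħ m)) := by
  intro γ hγ hper hT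
  have hdiff : Differentiable ℝ γ := hγ.differentiable (by simp)
  have hcoord : ∀ j, ContDiff ℝ 1 fun s => γ s j := fun j =>
    (((EuclideanSpace.proj j : EuclideanSpace ℂ (Fin n) →L[ℂ] ℂ).restrictScalars
      ℝ).contDiff.comp hγ).of_le (by simp)
  have hderiv : ∀ j t, deriv γ t j = deriv (fun s => γ s j) t := fun j t =>
    (hasDerivAt_coord hdiff t j).deriv.symm
  have hloop : γ (2 * Real.pi) = γ 0 := by simpa using hper 0
  choose w hw using fun j => exists_int_integral_circle (hcoord j) (by simp only [hloop])
    (fun t => mem_invariantTorus_iff.1 (hT t) j)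
  refine ⟨∑ j, m j * w j, ?_⟩
  rw [liouvilleIntegral, intervalIntegral.integral_finsetSum]
  · simp_rw [hderiv, hw]
    push_cast
    rw [Finset.mul_sum]
    refine Finset.sum_congr rfl fun j _ => ?_
    simp only [quantumVec]
    ring
  · intro j _
    refine Continuous.intervalIntegrable ?_ _ _
    simp_rw [hderiv]
    exact (Complex.continuous_re.comp (hcoord j).continuous).mul
      (Complex.continuous_im.comp ((hcoord j).continuous_deriv le_rfl))

/-- If the torus over `p` is quantized, then the loop turning once in the coordinate `j` shows that
`p j` is an integer multiple of `ħ`. -/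
theorem eq_quantumVec_of_isQuantized {n : ℕ} {ħ : ℝ} (hħ : 0 < ħ) {p : E n} (hp : p ∈ orthant n)
    (hq : IsQuantized ħ (invariantTorus p)) : ∃ m : Fin n → ℕ, p = quantumVec ħ m := by
  suffices H : ∀ j, ∃ m : ℕ, p j = ħ * m by
    choose m hm using H
    exact ⟨m, by ext j; exact hm j⟩
  intro j
  let z : EuclideanSpace ℂ (Fin n) := WithLp.toLp 2 fun i => ((√(2 * p i) : ℝ) : ℂ)
  have hzj : z j = ((√(2 * p j) : ℝ) : ℂ) := rfl
  let b : EuclideanSpace ℂ (Fin n) := EuclideanSpace.single j (z j)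
  let γ : ℝ → EuclideanSpace ℂ (Fin n) := fun t => z + (Complex.exp (t * Complex.I) - 1) • b
  have hsm : ContDiff ℝ ∞ fun t : ℝ => Complex.exp (t * Complex.I) :=
    ((Complex.ofRealCLM.contDiff (n := ∞)).mul contDiff_const).cexp
  have hγ : ContDiff ℝ ∞ γ := contDiff_const.add ((hsm.sub contDiff_const).smul contDiff_const)
  have hD : ∀ t : ℝ, HasDerivAt γ ((Complex.exp (t * Complex.I) * Complex.I) • b) t := by
    intro t
    have h1 : HasDerivAt (fun t : ℝ => Complex.exp (t * Complex.I))
        (Complex.exp (t * Complex.I) * Complex.I) t := by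
      simpa using (((hasDerivAt_id t).ofReal_comp).mul_const Complex.I).cexp
    exact ((h1.sub_const 1).smul_const b).const_add z
  have hper : Function.Periodic γ (2 * Real.pi) := by
    intro t
    have : Complex.exp (((t + 2 * Real.pi : ℝ) : ℂ) * Complex.I) =
        Complex.exp (t * Complex.I) := by
      push_cast
      rw [add_mul, Complex.exp_add, Complex.exp_two_pi_mul_I, mul_one]
    simp only [γ, this]
  have hγj : ∀ t, γ t j = Complex.exp (t * Complex.I) * z j := by
    intro t
    simp [γ, b]
    ring
  have hγi : ∀ t i, i ≠ j → γ t i = z i := by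
    intro t i hi
    simp [γ, b, hi]
  have hT : ∀ t, γ t ∈ invariantTorus p := by
    intro t
    rw [mem_invariantTorus_iff]
    intro i
    rw [← mem_invariantTorus_iff.1 (toLp_sqrt_mem_invariantTorus hp) i]
    by_cases hi : i = j
    · subst hi
      rw [hγj, norm_mul, Complex.norm_exp_ofReal_mul_I, one_mul]
    · rw [hγi t i hi]
  obtain ⟨m, hm⟩ := hq γ hγ hper hT
  have hint : ∀ t, ∑ i, (γ t i).re * (deriv γ t i).im = 2 * p j * Real.cos t ^ 2 := by
    intro t
    rw [Finset.sum_eq_single j]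
    · have h1 : (γ t j).re = √(2 * p j) * Real.cos t := by
        rw [hγj, hzj, Complex.re_mul_ofReal, Complex.exp_ofReal_mul_I_re, mul_comm]
      have h2 : (deriv γ t j).im = √(2 * p j) * Real.cos t := by
        have h3 : deriv γ t j = Complex.exp (t * Complex.I) * Complex.I * z j := by
          rw [(hD t).deriv]
          simp [b]
        rw [h3, hzj, Complex.im_mul_ofReal, Complex.mul_I_im, Complex.exp_ofReal_mul_I_re,
          mul_comm]
      rw [h1, h2]
      have := Real.sq_sqrt (mul_nonneg zero_le_two (hp j))
      linear_combination Real.cos t ^ 2 * this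
    · intro i _ hi
      rw [(hD t).deriv]
      simp [b, hi]
    · simp
  have hval : liouvilleIntegral γ = 2 * Real.pi * p j := by
    rw [liouvilleIntegral]
    simp_rw [hint]
    rw [intervalIntegral.integral_const_mul, integral_cos_sq]
    simp
    ring
  rw [hval] at hm
  have hpj : p j = ħ * m := mul_left_cancel₀ Real.two_pi_pos.ne' (by rw [hm]; ring)
  have hm0 : (0 : ℝ) ≤ m := by
    by_contra hneg
    push Not at hneg
    exact (hp j).not_gt (hpj ▸ mul_neg_of_pos_of_neg hħ hneg)
  lift m to ℕ using (by exact_mod_cast hm0)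
  exact ⟨m, by simpa using hpj⟩

theorem quantumVec_mem_orthant {n : ℕ} {ħ : ℝ} (hħ : 0 < ħ) (m : Fin n → ℕ) :
    quantumVec ħ m ∈ orthant n := fun _ => mul_nonneg hħ.le (Nat.cast_nonneg _)

theorem ebkSpectrum_toricHamiltonian {n : ℕ} {ħ : ℝ} (hħ : 0 < ħ) (f : E n → ℝ) :
    ebkSpectrum ħ (toricHamiltonian f) = {e | ∃ m : Fin n → ℕ, e = f (quantumVec ħ m)} := by
  ext e
  constructor
  · rintro ⟨p, hp, hsub, hq⟩
    obtain ⟨m, rfl⟩ := eq_quantumVec_of_isQuantized hħ hp hq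
    have hz := toLp_sqrt_mem_invariantTorus hp
    have h1 : f (momentMap _) = e := hsub hz
    have h2 : momentMap _ = quantumVec ħ m := hz
    exact ⟨m, by rw [← h1, h2]⟩
  · rintro ⟨m, rfl⟩
    refine ⟨_, quantumVec_mem_orthant hħ m, fun z hz => ?_,
      isQuantized_invariantTorus_quantumVec ħ m⟩
    have h2 : momentMap z = quantumVec ħ m := hz
    change f (momentMap z) = _
    rw [h2]

end ToricEBK

end

open ToricEBK in
theorem theorem1 (n : ℕ) (d : ℝ) (hd : 0 < d) (ħ : ℝ) (hħ : 0 < ħ)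
    (f : EuclideanSpace ℝ (Fin n) → ℝ)
    (hf_nonneg : ∀ p ∈ orthant n, 0 ≤ f p)
    (hf_smooth : ContDiffOn ℝ ∞ f (orthant n \ {0}))
    (hf_hom : ∀ p ∈ orthant n, ∀ t : ℝ, 0 < t → f (t • p) = t ^ d * f p)
    (hN_compact : IsCompact (levelSet f))
    (hN_curv : levelSet f ⊆ closure {p | HasNonzeroGaussCurvature (levelSet f) p}) :
    levelSet f = reconstruction (markedActionSpectrum f) ∧
    ebkSpectrum ħ (toricHamiltonian f) = {e | ∃ m : Fin n → ℕ, e = f (quantumVec ħ m)} ∧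
    ebkSpectrum ħ (toricHamiltonian f) =
      {e | e = 0 ∨ (0 < e ∧ ∃ m : Fin n → ℕ,
        (e ^ (1 / d))⁻¹ • quantumVec ħ m ∈ reconstruction (markedActionSpectrum f))} := by
  have h : IsHomogeneousOnOrthant d f := ⟨hd, hf_nonneg, hf_smooth, hf_hom⟩
  rw [h.reconstruction_eq hN_compact hN_curv, ebkSpectrum_toricHamiltonian hħ]
  refine ⟨rfl, rfl, ?_⟩
  -- `f (ħ m) = e` exactly when `e ^ (-1 / d) ħ m` lies on the level set
  have hscale : ∀ (e : ℝ), 0 < e → ∀ m : Fin n → ℕ,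
      (e ^ (1 / d))⁻¹ • quantumVec ħ m ∈ levelSet f ↔ e = f (quantumVec ħ m) := by
    intro e he m
    have hpos : 0 < (e ^ (1 / d))⁻¹ := inv_pos.2 (Real.rpow_pos_of_pos he _)
    have hpow : ((e ^ (1 / d))⁻¹) ^ d = e⁻¹ := by
      rw [Real.inv_rpow (Real.rpow_nonneg he.le _), ← Real.rpow_mul he.le, one_div,
        inv_mul_cancel₀ hd.ne', Real.rpow_one]
    have hm := quantumVec_mem_orthant hħ m
    change (_ ∧ f _ = 1) ↔ _
    rw [and_iff_right (smul_mem_orthant hm hpos.le), h.hom _ hm _ hpos, hpow,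
      inv_mul_eq_one₀ he.ne']
  ext e
  constructor
  · rintro ⟨m, hm⟩
    rcases (h.nonneg _ (quantumVec_mem_orthant hħ m)).eq_or_lt with h0 | h0
    · exact Or.inl (hm.trans h0.symm)
    · rw [← hm] at h0
      exact Or.inr ⟨h0, m, (hscale e h0 m).2 hm⟩
  · rintro (rfl | ⟨he, m, hm⟩)
    · refine ⟨0, ?_⟩
      have : quantumVec ħ (0 : Fin n → ℕ) = 0 := by ext j; simp [quantumVec]
      rw [this, h.map_zero]
    · exact ⟨m, (hscale e he m).1 hm⟩
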